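/- Fix $n\ge 0$ and let $\beta=\cos^2(\pi/8)$. In the $n$-fold parallel $\mathbf{B}_{84}$ task there are two input points $c_1,c_2$ and two output points $r_1,r_2$; bit strings $q,b\in\{0,1\}^n$ are drawn independently and uniformly at random. At $c_1$ one receives $n$ qubits in the state $\bigotimes_{i=1}^n H^{q_i}|b_i\rangle$, where $H$ is the Hadamard operator, and at $c_2$ one receives the classical string $q$. The task succeeds if the whole string $b$ is output both at $r_1$ and at $r_2$. The task is carried out without a central region (a region in the future of $c_1$ and $c_2$ and in the past of $r_1$ and $r_2$), using a resource state $\rho_{AB}$ on finite-dimensional systems, with $A$ available at $c_1$ and $B$ available at $c_2$. That is: a quantum channel is applied at $c_1$ to the $n$ qubits and $A$, with output a pair of systems $M_1M_2$; a quantum channel that may depend on $q$ is applied at $c_2$ to $B$, with output a pair of systems $N_1N_2$; the systems $M_1,N_1$ and $q$ are sent to $r_1$ and the systems $M_2,N_2$ and $q$ are sent to $r_2$; and for $j=1,2$ the string output at $r_j$ is the outcome of a measurement (POVM), which may depend on $q$, of $M_jN_j$. All systems are finite-dimensional. If such a protocol has success probability $p_{\text{suc}}\ge 1-\epsilon$ (averaged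 over $q$ and $b$), then $$\frac12 I(A:B)_\rho\ \ge\ -\log\left[2(\epsilon+\beta^n)\right],$$ where $I(A:B)_\rho=S(\rho_A)+S(\rho_B)-S(\rho_{AB})$ with $S(\rho)=-\operatorname{tr}(\rho\log\rho)$, and $\log$ is the natural logarithm throughout (equivalently, the logarithm to any fixed base greater than 1, used on both sides). -/

import Mathlib

open scoped Matrix Kronecker ComplexOrder

noncomputable section

namespace B84

/-! ## Finite-dimensional quantum systems

A finite-dimensional quantum system is given by the finite type labelling an orthonormal basis of
its Hilbert space; the composite of the systems `X` and `Y` is the system `X × Y`. -/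

/-- Density matrices: positive semidefinite matrices of trace one. -/
def IsDensity {X : Type*} [Fintype X] (ρ : Matrix X X ℂ) : Prop :=
  ρ.PosSemidef ∧ ρ.trace = 1

/-- The reduced state on the first factor (the partial trace over the second one). -/
def reduceFst {X Y : Type*} [Fintype Y] (ρ : Matrix (X × Y) (X × Y) ℂ) : Matrix X X ℂ :=
  Matrix.of fun x x' => ∑ y, ρ (x, y) (x', y)

/-- The reduced state on the second factor (the partial trace over the first one). -/
def reduceSnd {X Y : Type*} [Fintype X] (ρ : Matrix (X × Y) (X × Y) ℂ) : Matrix Y Y ℂ :=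
  Matrix.of fun y y' => ∑ x, ρ (x, y) (x, y')

/-- The von Neumann entropy `S(ρ) = - tr (ρ log ρ)`, with the natural logarithm; `log ρ` is given
by the functional calculus, and `0 log 0 = 0`. -/
def entropy {X : Type*} [Fintype X] [DecidableEq X] (ρ : Matrix X X ℂ) : ℝ :=
  -((ρ * cfc Real.log ρ).trace).re

/-- The mutual information `I(A:B) = S(ρ_A) + S(ρ_B) - S(ρ_AB)`. -/
def mutualInfo {A B : Type*} [Fintype A] [Fintype B] [DecidableEq A] [DecidableEq B]
    (ρ : Matrix (A × B) (A × B) ℂ) : ℝ :=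
  entropy (reduceFst ρ) + entropy (reduceSnd ρ) - entropy ρ

/-- A quantum channel (completely positive trace-preserving map) from the system `X` to the system
`Y`, given by finitely many Kraus operators: it sends `ρ` to `∑ k, K k * ρ * (K k)ᴴ`. -/
structure Channel (X Y : Type*) [Fintype X] [Fintype Y] [DecidableEq X] where
  /-- the number of Kraus operators -/
  num : ℕ
  /-- the Kraus operators -/
  kraus : Fin num → Matrix Y X ℂ
  /-- preservation of the trace -/
  sum_kraus : ∑ k, (kraus k)ᴴ * kraus k = 1

/-- The action of the product channel `Φ ⊗ Ψ` on a state of the composite system `X × Z`. -/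
def Channel.applyProd {X Y Z W : Type*} [Fintype X] [Fintype Y] [Fintype Z] [Fintype W]
    [DecidableEq X] [DecidableEq Z] (Φ : Channel X Y) (Ψ : Channel Z W)
    (ρ : Matrix (X × Z) (X × Z) ℂ) : Matrix (Y × W) (Y × W) ℂ :=
  ∑ k, ∑ l, (Φ.kraus k ⊗ₖ Ψ.kraus l) * ρ * (Φ.kraus k ⊗ₖ Ψ.kraus l)ᴴ

/-- A measurement (POVM) on the system `X` with outcomes in `O`. -/
structure POVM (X O : Type*) [Fintype X] [DecidableEq X] [Fintype O] where
  /-- the effect of each outcome -/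
  effect : O → Matrix X X ℂ
  /-- effects are positive semidefinite -/
  posSemidef : ∀ o, (effect o).PosSemidef
  /-- the effects sum to the identity -/
  sum_effect : ∑ o, effect o = 1

/-! ## The task -/

/-- Strings of `n` bits. They also label the computational basis of `n` qubits. -/
abbrev Bits (n : ℕ) : Type := Fin n → Fin 2

/-- The Hadamard operator: `H|0⟩ = |+⟩` and `H|1⟩ = |-⟩`. -/
def hadamard : Matrix (Fin 2) (Fin 2) ℂ :=
  ((1 / Real.sqrt 2 : ℝ) : ℂ) • !![1, 1; 1, -1]

/-- The amplitudes of the qubit state `H^q |b⟩`. -/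
def inputKet (q b : Fin 2) : Fin 2 → ℂ :=
  (hadamard ^ (q : ℕ)) *ᵥ Pi.single b 1

/-- The amplitudes of the `n`-qubit product state `⨂ i, H^(q i) |b i⟩`. -/
def inputKets {n : ℕ} (q b : Bits n) : Bits n → ℂ :=
  fun x => ∏ i, inputKet (q i) (b i) (x i)

/-- The density matrix of the `n`-qubit state received at the first input point. -/
def inputState {n : ℕ} (q b : Bits n) : Matrix (Bits n) (Bits n) ℂ :=
  Matrix.vecMulVec (inputKets q b) (star (inputKets q b))

/-- A protocol for the `n`-fold parallel task that makes no use of the central region, i.e. of the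
points lying both in the future of `c₁` and `c₂` and in the past of `r₁` and `r₂`.
At `c₁`, the `n` received qubits and the half `A` of the resource undergo a channel, whose output
`M₁` is sent to `r₁` and `M₂` to `r₂`. At `c₂`, the half `B` of the resource undergoes a channel
which may depend on the received string `q`, and whose output `N₁` is sent to `r₁` and `N₂` to
`r₂`; the classical string `q` itself is also forwarded to both output points. At `r₁` the system
`M₁ N₁` and at `r₂` the system `M₂ N₂` is measured, giving the two output strings. -/
structure Protocol (n : ℕ) (A B M₁ M₂ N₁ N₂ : Type*)
    [Fintype A] [Fintype B] [Fintype M₁] [Fintype M₂] [Fintype N₁] [Fintype N₂]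
    [DecidableEq A] [DecidableEq B] [DecidableEq M₁] [DecidableEq M₂]
    [DecidableEq N₁] [DecidableEq N₂] where
  /-- the operation at `c₁` -/
  opFst : Channel (Bits n × A) (M₁ × M₂)
  /-- the operation at `c₂` -/
  opSnd : Bits n → Channel B (N₁ × N₂)
  /-- the measurement at `r₁` -/
  measFst : Bits n → POVM (M₁ × N₁) (Bits n)
  /-- the measurement at `r₂` -/
  measSnd : Bits n → POVM (M₂ × N₂) (Bits n)

namespace Protocol

variable {n : ℕ} {A B M₁ M₂ N₁ N₂ : Type*}
  [Fintype A] [Fintype B] [Fintype M₁] [Fintype M₂] [Fintype N₁] [Fintype N₂]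
  [DecidableEq A] [DecidableEq B] [DecidableEq M₁] [DecidableEq M₂]
  [DecidableEq N₁] [DecidableEq N₂]

/-- The state of the systems `(M₁ N₁) (M₂ N₂)` arriving at the output points, on the inputs `q` and
`b` and with the resource state `ρ` (the factors are regrouped before and after the operations at
the input points). -/
def finalState (P : Protocol n A B M₁ M₂ N₁ N₂) (ρ : Matrix (A × B) (A × B) ℂ) (q b : Bits n) :
    Matrix ((M₁ × N₁) × (M₂ × N₂)) ((M₁ × N₁) × (M₂ × N₂)) ℂ :=
  Matrix.reindex (Equiv.prodProdProdComm M₁ M₂ N₁ N₂) (Equiv.prodProdProdComm M₁ M₂ N₁ N₂)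
    (P.opFst.applyProd (P.opSnd q)
      (Matrix.reindex (Equiv.prodAssoc (Bits n) A B).symm (Equiv.prodAssoc (Bits n) A B).symm
        (inputState q b ⊗ₖ ρ)))

/-- The probability that the string `b` is output at `r₁` and also at `r₂`, on the inputs `q`
and `b`. -/
def successProbOn (P : Protocol n A B M₁ M₂ N₁ N₂) (ρ : Matrix (A × B) (A × B) ℂ)
    (q b : Bits n) : ℝ :=
  ((((P.measFst q).effect b ⊗ₖ (P.measSnd q).effect b) * P.finalState ρ q b).trace).re

/-- The success probability, the `2 n` input bits being independent and uniformly distributed. -/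
def successProb (P : Protocol n A B M₁ M₂ N₁ N₂) (ρ : Matrix (A × B) (A × B) ℂ) : ℝ :=
  (∑ q : Bits n, ∑ b : Bits n, P.successProbOn ρ q b) / (2 ^ n * 2 ^ n)

end Protocol

end B84

end

noncomputable section

set_option linter.unusedSectionVars false

namespace B84

open scoped MatrixOrder Matrix.Norms.L2Operator

open Filter Topology

/-! ### A comparison principle for sums of logarithms -/

/-! Replace the operations at the input points by Stinespring isometries, and feed the first one
half of a maximally entangled state whose other half is a reference R. Measuring R in the basis q
then prepares a uniformly random input b. For each q the game becomes a test 0 ≤ W_q ≤ 1 (`winOp`):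
both output strings agree with the outcome on R. Its mean in a state obtained from ρ by local
isometries, hence with the same mutual information, is the success probability p_q for that q
(`winProb_eq_sum_successProbOn`).

The entropic input is I(A:B) ≥ tr ρ log T − tr ρ_A log tr_B(ρ_B T) for positive definite T
(`trace_mul_log_sub_le_mutualInfo`), a form of Lieb's three matrix inequality. It follows from joint
subadditivity of the relative entropy, applied to a first order perturbation of a product state, and
from Jensen's inequality for the logarithm. With T = W_q + δ the first term is at least (1 − p_q)
log δ. The second involves only the slice X_q of W_q on R M₁ M₂ (`winSlice`), in a state independent
of q, because what leaves c₁ cannot depend on q. So it remains to show that the slices X_q are small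
on average.

X_q lies below an operator that ignores M₂, and X_q' below one that ignores M₁. For such operators
X_q X_q' X_q ≤ C X_q, where C bounds the squared overlaps of the bases q and q'
(`overlap_mul_mul_le`, `mul_mul_le_of_le`). This is used twice. For complementary q and q' it bounds
the sum of the two expected logarithms, giving I ≥ log 2 (n/2 − εn − 1)
(`uncertainty_le_mutualInfo`). Over all q it bounds the norm of the sum of the X_q by 2^n β^n,
giving I ≥ ε log β^n − log(2β^n) (`monogamy_le_mutualInfo`). Together with I ≥ 0, these two bounds
imply the claim by a case analysis on n and ε + β^n (`neg_log_le_half_of_bounds`). -/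

lemma sum_mul_log_le_of_sum_div_le {ι κ : Type*} [Fintype ι] [Fintype κ]
    (c x : ι → ℝ) (d y : κ → ℝ) (hx : ∀ i, c i ≠ 0 → 0 < x i) (hy : ∀ k, d k ≠ 0 → 0 < y k)
    (hsum : ∑ i, c i = ∑ k, d k)
    (h : ∀ t, 0 < t → ∑ i, c i / (x i + t) ≤ ∑ k, d k / (y k + t)) :
    ∑ k, d k * Real.log (y k) ≤ ∑ i, c i * Real.log (x i) := by
  have hder : ∀ (a b t : ℝ), (a ≠ 0 → 0 < b) → 0 ≤ t →
      HasDerivAt (fun s => a * Real.log (b + s)) (a / (b + t)) t := by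
    intro a b t hab ht
    by_cases ha : a = 0
    · simp only [ha, zero_mul, zero_div]
      exact hasDerivAt_const t (0 : ℝ)
    · have hb : b + t ≠ 0 := by have := hab ha; positivity
      have := (((hasDerivAt_id t).const_add b).log hb).const_mul a
      simpa [div_eq_mul_inv] using this
  have hlim : ∀ (a b : ℝ), (a ≠ 0 → 0 < b) →
      Tendsto (fun t => a * Real.log (b + t) - a * Real.log t) atTop (𝓝 0) := by
    intro a b hab
    by_cases ha : a = 0
    · simp [ha]
    · have hb := hab ha
      have h1 : Tendsto (fun t : ℝ => 1 + b / t) atTop (𝓝 (1 + 0)) :=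
        tendsto_const_nhds.add (tendsto_const_nhds.div_atTop tendsto_id)
      have h2 := ((Real.continuousAt_log (by norm_num : (1 + 0 : ℝ) ≠ 0)).tendsto.comp h1).const_mul a
      simp only [add_zero, Real.log_one, mul_zero] at h2
      refine h2.congr' ?_
      filter_upwards [eventually_gt_atTop 0] with t ht
      have : 1 + b / t = (b + t) / t := by field_simp; ring
      simp only [Function.comp]
      rw [this, Real.log_div (by positivity) ht.ne']
      ring
  -- Logarithms are integrals of resolvents: F' is the difference of the two resolvent sums, so F is
  -- nondecreasing on [0, ∞), and F tends to 0 at infinity because the total weights agree. Hence F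
  -- 0 ≤ 0, which is the claim.
  set F : ℝ → ℝ := fun t => ∑ k, d k * Real.log (y k + t) - ∑ i, c i * Real.log (x i + t) with hF
  have hFd : ∀ t, 0 ≤ t → HasDerivAt F (∑ k, d k / (y k + t) - ∑ i, c i / (x i + t)) t := by
    intro t ht
    exact (HasDerivAt.fun_sum fun k _ => hder _ _ t (hy k) ht).sub
      (HasDerivAt.fun_sum fun i _ => hder _ _ t (hx i) ht)
  have hmono : MonotoneOn F (Set.Ici 0) := by
    refine monotoneOn_of_deriv_nonneg (convex_Ici 0)
      (fun t ht => (hFd t ht).continuousAt.continuousWithinAt)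
      (fun t ht => ?_) (fun t ht => ?_)
    · rw [interior_Ici] at ht
      exact (hFd t (le_of_lt ht)).differentiableAt.differentiableWithinAt
    · rw [interior_Ici] at ht
      rw [(hFd t (le_of_lt ht)).deriv]
      exact sub_nonneg.2 (h t ht)
  have hF0 : Tendsto F atTop (𝓝 0) := by
    have h1 := (tendsto_finsetSum Finset.univ fun k _ => hlim (d k) (y k) (hy k)).sub
      (tendsto_finsetSum Finset.univ fun i _ => hlim (c i) (x i) (hx i))
    simp only [Finset.sum_const_zero, sub_zero] at h1
    refine h1.congr fun t => ?_
    simp only [hF, Finset.sum_sub_distrib, ← Finset.sum_mul, hsum]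
    ring
  have h0 : F 0 ≤ 0 := by
    refine ge_of_tendsto hF0 ?_
    filter_upwards [eventually_ge_atTop 0] with t ht
    exact hmono (Set.mem_Ici.2 le_rfl) ht ht
  simp only [hF, add_zero] at h0
  linarith

/-! ### Functional calculus of Hermitian matrices and traces -/

section Spectral

variable {X : Type*} [Fintype X] [DecidableEq X]

/-- The diagonal of `ω` in the eigenbasis of a Hermitian matrix. -/
def eigenWeight (ω : Matrix X X ℂ) {Y : Matrix X X ℂ} (hY : Y.IsHermitian) (j : X) : ℝ :=
  ((star (hY.eigenvectorUnitary : Matrix X X ℂ) * ω * hY.eigenvectorUnitary) j j).re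

lemma cfc_eq_conj {Y : Matrix X X ℂ} (hY : Y.IsHermitian) (f : ℝ → ℝ) :
    cfc f Y = (hY.eigenvectorUnitary : Matrix X X ℂ) *
      Matrix.diagonal (fun j => (f (hY.eigenvalues j) : ℂ)) *
      star (hY.eigenvectorUnitary : Matrix X X ℂ) := by
  rw [hY.cfc_eq]; rfl

lemma trace_mul_cfc (ω : Matrix X X ℂ) {Y : Matrix X X ℂ} (hY : Y.IsHermitian) (f : ℝ → ℝ) :
    ((ω * cfc f Y).trace).re = ∑ j, eigenWeight ω hY j * f (hY.eigenvalues j) := by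
  rw [cfc_eq_conj hY, ← Matrix.mul_assoc, Matrix.trace_mul_comm, ← Matrix.mul_assoc,
    ← Matrix.mul_assoc, Matrix.trace]
  simp [Matrix.mul_diagonal, eigenWeight, Matrix.diag]

lemma eigenWeight_nonneg {ω : Matrix X X ℂ} (hω : ω.PosSemidef) {Y : Matrix X X ℂ}
    (hY : Y.IsHermitian) (j : X) : 0 ≤ eigenWeight ω hY j := by
  have := (hω.conjTranspose_mul_mul_same (hY.eigenvectorUnitary : Matrix X X ℂ)).diag_nonneg (i := j)
  exact (Complex.le_def.1 this).1

lemma continuousOn_spectrum (Y : Matrix X X ℂ) (f : ℝ → ℝ) : ContinuousOn f (spectrum ℝ Y) :=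
  Y.finite_real_spectrum.continuousOn f

lemma sum_eigenWeight (ω : Matrix X X ℂ) {Y : Matrix X X ℂ} (hY : Y.IsHermitian) :
    ∑ j, eigenWeight ω hY j = (ω.trace).re := by
  have := trace_mul_cfc ω hY (fun _ => 1)
  rw [cfc_const_one ℝ Y hY.isSelfAdjoint] at this
  simpa using this.symm

lemma trace_mul_nonneg {ω Y : Matrix X X ℂ} (hω : ω.PosSemidef) (hY : Y.PosSemidef) :
    0 ≤ ((ω * Y).trace).re := by
  have := trace_mul_cfc ω hY.1 id
  rw [cfc_id ℝ Y hY.1.isSelfAdjoint] at this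
  rw [this]
  exact Finset.sum_nonneg fun j _ => mul_nonneg (eigenWeight_nonneg hω _ _) (hY.eigenvalues_nonneg j)

lemma trace_mul_le {ω Y Z : Matrix X X ℂ} (hω : ω.PosSemidef) (h : Y ≤ Z) :
    ((ω * Y).trace).re ≤ ((ω * Z).trace).re := by
  have := trace_mul_nonneg hω (Matrix.le_iff.1 h)
  rw [Matrix.mul_sub, Matrix.trace_sub, Complex.sub_re] at this
  linarith

/-- The resolvent. -/
lemma inv_add_smul_eq_cfc {Y : Matrix X X ℂ} (hY : Y.PosDef) {t : ℝ} (ht : 0 ≤ t) :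
    (Y + t • (1 : Matrix X X ℂ))⁻¹ = cfc (fun x : ℝ => 1 / (x + t)) Y := by
  refine Matrix.inv_eq_right_inv ?_
  have hsa := hY.1.isSelfAdjoint
  have h1 : Y + t • (1 : Matrix X X ℂ) = cfc (fun x : ℝ => x + t) Y := by
    rw [cfc_add_const t (fun x => x) Y (continuousOn_spectrum _ _) hsa, cfc_id' ℝ Y,
      Algebra.algebraMap_eq_smul_one]
  rw [h1, ← cfc_mul _ _ Y (continuousOn_spectrum _ _) (continuousOn_spectrum _ _),
    ← cfc_one ℝ Y hsa]
  refine cfc_congr fun x hx => ?_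
  rw [hY.1.spectrum_real_eq_range_eigenvalues] at hx
  obtain ⟨j, rfl⟩ := hx
  have := hY.eigenvalues_pos j
  have : hY.1.eigenvalues j + t ≠ 0 := by positivity
  simp only [Pi.one_apply]
  field_simp

lemma trace_mul_inv_add_smul (ω : Matrix X X ℂ) {Y : Matrix X X ℂ} (hY : Y.PosDef) {t : ℝ}
    (ht : 0 ≤ t) : ((ω * (Y + t • (1 : Matrix X X ℂ))⁻¹).trace).re =
      ∑ j, eigenWeight ω hY.1 j / (hY.1.eigenvalues j + t) := by
  rw [inv_add_smul_eq_cfc hY ht, trace_mul_cfc ω hY.1]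
  simp [div_eq_mul_inv]

lemma trace_mul_log_mono {ω Y Z : Matrix X X ℂ} (hω : ω.PosSemidef) (hY : Y.PosDef) (h : Y ≤ Z) :
    ((ω * cfc Real.log Y).trace).re ≤ ((ω * cfc Real.log Z).trace).re := by
  refine trace_mul_le hω ?_
  exact CFC.log_le_log h (Matrix.isStrictlyPositive_iff_posDef.2 hY)

end Spectral

/-! ### Functional calculus under intertwiners, isometries and tensor products -/

section Intertwine

variable {X Y : Type*} [Fintype X] [DecidableEq X] [Fintype Y] [DecidableEq Y]

/-- In an eigenbasis of `A` the hypothesis reads (λ_i − a_j) W_ij = 0, so λ_i = a_j wherever W_ij ≠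
0, and any `f` can be applied. Invertibility of `V` plays no role, so isometries are covered. -/
lemma cfc_mul_of_mul_eq_mul_diagonal {A : Matrix X X ℂ} (hA : A.IsHermitian) (V : Matrix X Y ℂ)
    (a : Y → ℝ) (h : A * V = V * Matrix.diagonal (fun j => (a j : ℂ))) (f : ℝ → ℝ) :
    cfc f A * V = V * Matrix.diagonal (fun j => (f (a j) : ℂ)) := by
  set U := (hA.eigenvectorUnitary : Matrix X X ℂ) with hU
  have hUU : star U * U = 1 := Unitary.coe_star_mul_self hA.eigenvectorUnitary
  have hUU' : U * star U = 1 := Unitary.coe_mul_star_self hA.eigenvectorUnitary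
  have hAU : A = U * Matrix.diagonal (fun j => (hA.eigenvalues j : ℂ)) * star U := by
    conv_lhs => rw [← cfc_id ℝ A hA.isSelfAdjoint]
    exact cfc_eq_conj hA id
  set W := star U * V with hW
  have hV : V = U * W := by rw [hW, ← Matrix.mul_assoc, hUU', Matrix.one_mul]
  have h1 : Matrix.diagonal (fun j => (hA.eigenvalues j : ℂ)) * W
      = W * Matrix.diagonal (fun j => (a j : ℂ)) := by
    have h2 := congrArg (fun M => star U * M) h
    rw [← Matrix.mul_assoc (star U) V, ← hW] at h2
    rw [← h2]
    conv_rhs => rw [hAU]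
    simp only [Matrix.mul_assoc]
    rw [← hW, ← Matrix.mul_assoc (star U) U, hUU, Matrix.one_mul]
  have h3 : Matrix.diagonal (fun j => (f (hA.eigenvalues j) : ℂ)) * W
      = W * Matrix.diagonal (fun j => (f (a j) : ℂ)) := by
    ext i j
    have := congrFun (congrFun h1 i) j
    simp only [Matrix.diagonal_mul, Matrix.mul_diagonal] at this ⊢
    by_cases hw : W i j = 0
    · simp [hw]
    · have : (hA.eigenvalues i : ℂ) = a j := by
        rw [mul_comm] at this
        exact mul_left_cancel₀ hw this
      rw [Complex.ofReal_inj.1 this, mul_comm]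
  rw [cfc_eq_conj hA f]
  conv_rhs => rw [hV, Matrix.mul_assoc, ← h3]
  simp only [← hU, Matrix.mul_assoc, ← hW]

lemma cfc_mul_of_mul_eq_mul {A : Matrix X X ℂ} (hA : A.IsHermitian) {B : Matrix Y Y ℂ}
    (hB : B.IsHermitian) (V : Matrix X Y ℂ) (h : A * V = V * B) (f : ℝ → ℝ) :
    cfc f A * V = V * cfc f B := by
  set U := (hB.eigenvectorUnitary : Matrix Y Y ℂ) with hU
  have hUU : star U * U = 1 := Unitary.coe_star_mul_self hB.eigenvectorUnitary
  have hUU' : U * star U = 1 := Unitary.coe_mul_star_self hB.eigenvectorUnitary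
  have hBU : B = U * Matrix.diagonal (fun j => (hB.eigenvalues j : ℂ)) * star U := by
    conv_lhs => rw [← cfc_id ℝ B hB.isSelfAdjoint]
    exact cfc_eq_conj hB id
  have h1 : A * (V * U) = (V * U) * Matrix.diagonal (fun j => (hB.eigenvalues j : ℂ)) := by
    rw [← Matrix.mul_assoc, h]
    conv_lhs => rw [hBU]
    simp only [Matrix.mul_assoc, hUU, Matrix.mul_one]
  have h2 := cfc_mul_of_mul_eq_mul_diagonal hA (V * U) _ h1 f
  have h3 := congrArg (fun M => M * star U) h2
  simp only [Matrix.mul_assoc, hUU', Matrix.mul_one] at h3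
  rw [h3, cfc_eq_conj hB f]
  simp only [← hU, Matrix.mul_assoc]

lemma entropy_conj_isometry {V : Matrix X Y ℂ} (hV : Vᴴ * V = 1) {B : Matrix Y Y ℂ}
    (hB : B.IsHermitian) : entropy (V * B * Vᴴ) = entropy B := by
  have hA : (V * B * Vᴴ).IsHermitian := by
    unfold Matrix.IsHermitian
    rw [Matrix.conjTranspose_mul, Matrix.conjTranspose_mul, Matrix.conjTranspose_conjTranspose,
      hB.eq, Matrix.mul_assoc]
  have h := cfc_mul_of_mul_eq_mul hA hB V
    (by rw [Matrix.mul_assoc (V * B), hV, Matrix.mul_one]) Real.log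
  unfold entropy
  rw [Matrix.mul_assoc V B, Matrix.mul_assoc V, Matrix.trace_mul_comm, Matrix.mul_assoc,
    Matrix.mul_assoc, ← Matrix.mul_assoc V B, h, ← Matrix.mul_assoc Vᴴ, hV, Matrix.one_mul]

/-- The products of eigenvectors diagonalize both sides, and the logarithm of a product of
eigenvalues splits because all of them are positive. -/
lemma cfc_log_kronecker {α : Matrix X X ℂ} {ω : Matrix Y Y ℂ} (hα : α.PosDef) (hω : ω.PosDef) :
    cfc Real.log (α ⊗ₖ ω) = cfc Real.log α ⊗ₖ (1 : Matrix Y Y ℂ)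
      + (1 : Matrix X X ℂ) ⊗ₖ cfc Real.log ω := by
  set U := (hα.1.eigenvectorUnitary : Matrix X X ℂ) with hU
  have hUU' : U * star U = 1 := Unitary.coe_mul_star_self hα.1.eigenvectorUnitary
  have hUU : star U * U = 1 := Unitary.coe_star_mul_self hα.1.eigenvectorUnitary
  set V := (hω.1.eigenvectorUnitary : Matrix Y Y ℂ) with hV
  have hVV' : V * star V = 1 := Unitary.coe_mul_star_self hω.1.eigenvectorUnitary
  have hVV : star V * V = 1 := Unitary.coe_star_mul_self hω.1.eigenvectorUnitary
  have key : ∀ f : ℝ → ℝ, cfc f α * U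
      = U * Matrix.diagonal (fun j => (f (hα.1.eigenvalues j) : ℂ)) := by
    intro f
    rw [cfc_eq_conj hα.1 f, ← hU, Matrix.mul_assoc, hUU, Matrix.mul_one]
  have key' : ∀ f : ℝ → ℝ, cfc f ω * V
      = V * Matrix.diagonal (fun j => (f (hω.1.eigenvalues j) : ℂ)) := by
    intro f
    rw [cfc_eq_conj hω.1 f, ← hV, Matrix.mul_assoc, hVV, Matrix.mul_one]
  have hα1 := key id
  have hω1 := key' id
  rw [cfc_id ℝ α hα.1.isSelfAdjoint] at hα1
  rw [cfc_id ℝ ω hω.1.isSelfAdjoint] at hω1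
  have h1 : (α ⊗ₖ ω) * (U ⊗ₖ V) = (U ⊗ₖ V) * Matrix.diagonal
      (fun j : X × Y => ((hα.1.eigenvalues j.1 * hω.1.eigenvalues j.2 : ℝ) : ℂ)) := by
    rw [← Matrix.mul_kronecker_mul, hα1, hω1, Matrix.mul_kronecker_mul,
      Matrix.diagonal_kronecker_diagonal]
    simp
  have h2 := cfc_mul_of_mul_eq_mul_diagonal (hα.kronecker hω).1 (U ⊗ₖ V) _ h1 Real.log
  have h3 : (cfc Real.log α ⊗ₖ (1 : Matrix Y Y ℂ) + (1 : Matrix X X ℂ) ⊗ₖ cfc Real.log ω)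
      * (U ⊗ₖ V) = (U ⊗ₖ V) * Matrix.diagonal
      (fun j : X × Y => (Real.log (hα.1.eigenvalues j.1 * hω.1.eigenvalues j.2) : ℂ)) := by
    rw [Matrix.add_mul, ← Matrix.mul_kronecker_mul, ← Matrix.mul_kronecker_mul, key, key',
      Matrix.one_mul, Matrix.one_mul]
    conv_lhs => rw [← Matrix.mul_one V, ← Matrix.mul_one U]
    simp only [Matrix.mul_assoc, Matrix.one_mul]
    rw [Matrix.mul_kronecker_mul, Matrix.mul_kronecker_mul, ← Matrix.mul_add,
      ← Matrix.diagonal_one, ← Matrix.diagonal_one, Matrix.diagonal_kronecker_diagonal,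
      Matrix.diagonal_kronecker_diagonal, Matrix.diagonal_add]
    congr 2
    ext j
    rw [Real.log_mul (hα.eigenvalues_pos _).ne' (hω.eigenvalues_pos _).ne']
    simp
  have h4 : (U ⊗ₖ V) * (star U ⊗ₖ star V) = 1 := by
    rw [← Matrix.mul_kronecker_mul, hUU', hVV', Matrix.one_kronecker_one]
  have h5 := congrArg (fun M => M * (star U ⊗ₖ star V)) (h2.trans h3.symm)
  simpa only [Matrix.mul_assoc, h4, Matrix.mul_one] using h5

lemma cfc_kronecker_one {α : Matrix X X ℂ} (hα : α.IsHermitian) (f : ℝ → ℝ) :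
    cfc f (α ⊗ₖ (1 : Matrix Y Y ℂ)) = cfc f α ⊗ₖ (1 : Matrix Y Y ℂ) := by
  set U := (hα.eigenvectorUnitary : Matrix X X ℂ) with hU
  have hUU' : U * star U = 1 := Unitary.coe_mul_star_self hα.eigenvectorUnitary
  have hUU : star U * U = 1 := Unitary.coe_star_mul_self hα.eigenvectorUnitary
  have hd : ∀ d : X → ℂ, Matrix.diagonal d ⊗ₖ (1 : Matrix Y Y ℂ)
      = Matrix.diagonal (fun j : X × Y => d j.1) := by
    intro d
    rw [← Matrix.diagonal_one, Matrix.diagonal_kronecker_diagonal]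
    simp
  have key : ∀ f : ℝ → ℝ, (cfc f α ⊗ₖ (1 : Matrix Y Y ℂ)) * (U ⊗ₖ (1 : Matrix Y Y ℂ))
      = (U ⊗ₖ (1 : Matrix Y Y ℂ)) *
        Matrix.diagonal (fun j : X × Y => (f (hα.eigenvalues j.1) : ℂ)) := by
    intro f
    rw [← hd (fun i => (f (hα.eigenvalues i) : ℂ)), ← Matrix.mul_kronecker_mul, ← Matrix.mul_kronecker_mul,
      cfc_eq_conj hα f, ← hU, Matrix.mul_assoc, hUU, Matrix.mul_one]
  have h1 := key id
  rw [cfc_id ℝ α hα.isSelfAdjoint] at h1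
  have hA : (α ⊗ₖ (1 : Matrix Y Y ℂ)).IsHermitian := by
    unfold Matrix.IsHermitian
    rw [Matrix.conjTranspose_kronecker, hα.eq, Matrix.conjTranspose_one]
  have h2 := cfc_mul_of_mul_eq_mul_diagonal hA (U ⊗ₖ (1 : Matrix Y Y ℂ)) _ h1 f
  have h4 : (U ⊗ₖ (1 : Matrix Y Y ℂ)) * (star U ⊗ₖ (1 : Matrix Y Y ℂ)) = 1 := by
    rw [← Matrix.mul_kronecker_mul, hUU', Matrix.one_mul, Matrix.one_kronecker_one]
  have h5 := congrArg (fun M => M * (star U ⊗ₖ (1 : Matrix Y Y ℂ))) (h2.trans (key f).symm)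
  simpa only [Matrix.mul_assoc, h4, Matrix.mul_one] using h5

end Intertwine

/-! ### Relative entropy -/

section RelEntropy

variable {X : Type*} [Fintype X] [DecidableEq X]

/-- The relative entropy `tr ρ (log ρ - log Y)`. -/
def relEntropy (ρ Y : Matrix X X ℂ) : ℝ :=
  ((ρ * cfc Real.log ρ).trace).re - ((ρ * cfc Real.log Y).trace).re

/-- The joint distribution of a pair of Hermitian matrices in their eigenbases: the weights. -/
def pairWeight {ρ Y : Matrix X X ℂ} (hρ : ρ.IsHermitian) (hY : Y.IsHermitian) (k : X × X) : ℝ :=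
  hρ.eigenvalues k.2 * Complex.normSq
    ((star (hY.eigenvectorUnitary : Matrix X X ℂ) * hρ.eigenvectorUnitary) k.1 k.2)

/-- The ratios of the eigenvalues of a pair of Hermitian matrices. -/
def pairRatio {ρ Y : Matrix X X ℂ} (hρ : ρ.IsHermitian) (hY : Y.IsHermitian) (k : X × X) : ℝ :=
  hY.eigenvalues k.1 / hρ.eigenvalues k.2

lemma eigenWeight_eq_sum {ρ Y : Matrix X X ℂ} (hρ : ρ.IsHermitian) (hY : Y.IsHermitian) (j : X) :
    eigenWeight ρ hY j = ∑ i, pairWeight hρ hY (j, i) := by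
  set U := (hY.eigenvectorUnitary : Matrix X X ℂ) with hU
  set V := (hρ.eigenvectorUnitary : Matrix X X ℂ) with hV
  have hρV : ρ = V * Matrix.diagonal (fun j => (hρ.eigenvalues j : ℂ)) * star V := by
    conv_lhs => rw [← cfc_id ℝ ρ hρ.isSelfAdjoint]
    exact cfc_eq_conj hρ id
  have h1 : star U * ρ * U
      = (star U * V) * Matrix.diagonal (fun j => (hρ.eigenvalues j : ℂ)) * star (star U * V) := by
    conv_lhs => rw [hρV]
    simp only [star_mul, star_star, Matrix.mul_assoc]
  unfold eigenWeight pairWeight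
  rw [← hU, h1, Matrix.mul_apply, Complex.re_sum]
  refine Finset.sum_congr rfl fun i _ => ?_
  rw [Matrix.mul_diagonal, Matrix.star_apply, mul_comm _ (hρ.eigenvalues i : ℂ), mul_assoc,
    Complex.star_def, Complex.mul_conj, ← Complex.ofReal_mul, Complex.ofReal_re]

lemma eigenWeight_self {ρ : Matrix X X ℂ} (hρ : ρ.IsHermitian) (i : X) :
    eigenWeight ρ hρ i = hρ.eigenvalues i := by
  rw [eigenWeight_eq_sum hρ hρ]
  have : star (hρ.eigenvectorUnitary : Matrix X X ℂ) * hρ.eigenvectorUnitary = 1 :=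
    Unitary.coe_star_mul_self hρ.eigenvectorUnitary
  simp [pairWeight, this, Matrix.one_apply, apply_ite]

lemma sum_normSq_overlap {ρ Y : Matrix X X ℂ} (hρ : ρ.IsHermitian) (hY : Y.IsHermitian) (i : X) :
    ∑ j, Complex.normSq
      ((star (hY.eigenvectorUnitary : Matrix X X ℂ) * hρ.eigenvectorUnitary) j i) = 1 := by
  set U := (hY.eigenvectorUnitary : Matrix X X ℂ) with hU
  set V := (hρ.eigenvectorUnitary : Matrix X X ℂ) with hV
  have hUU' : U * star U = 1 := Unitary.coe_mul_star_self hY.eigenvectorUnitary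
  have hVV : star V * V = 1 := Unitary.coe_star_mul_self hρ.eigenvectorUnitary
  have h1 : star (star U * V) * (star U * V) = 1 := by
    rw [star_mul, star_star, Matrix.mul_assoc, ← Matrix.mul_assoc U, hUU', Matrix.one_mul, hVV]
  have h2 := congrArg Complex.re (congrFun (congrFun h1 i) i)
  rw [Matrix.mul_apply, Complex.re_sum] at h2
  simp only [Matrix.one_apply_eq, Complex.one_re] at h2
  rw [← h2]
  refine Finset.sum_congr rfl fun j _ => ?_
  rw [Matrix.star_apply, mul_comm, Complex.star_def, Complex.mul_conj, Complex.ofReal_re]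

lemma overlap_sum_left {ρ Y : Matrix X X ℂ} (hρ : ρ.IsHermitian) (hY : Y.IsHermitian) (j : X) :
    ∑ i, Complex.normSq
      ((star (hY.eigenvectorUnitary : Matrix X X ℂ) * hρ.eigenvectorUnitary) j i) = 1 := by
  rw [← sum_normSq_overlap hY hρ j]
  refine Finset.sum_congr rfl fun i _ => ?_
  rw [← Complex.normSq_conj, ← Complex.star_def, ← Matrix.star_apply, star_mul, star_star]

lemma pairWeight_ne_zero {ρ Y : Matrix X X ℂ} (hρ : ρ.PosSemidef) (hY : Y.PosDef) (k : X × X)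
    (h : pairWeight hρ.1 hY.1 k ≠ 0) : 0 < hρ.1.eigenvalues k.2 :=
  lt_of_le_of_ne (hρ.eigenvalues_nonneg _) fun h0 => h (by simp [pairWeight, ← h0])

lemma pairRatio_pos {ρ Y : Matrix X X ℂ} (hρ : ρ.PosSemidef) (hY : Y.PosDef) (k : X × X)
    (h : pairWeight hρ.1 hY.1 k ≠ 0) : 0 < pairRatio hρ.1 hY.1 k :=
  div_pos (hY.eigenvalues_pos _) (pairWeight_ne_zero hρ hY k h)

lemma pairWeight_nonneg {ρ Y : Matrix X X ℂ} (hρ : ρ.PosSemidef) (hY : Y.IsHermitian) (k : X × X) :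
    0 ≤ pairWeight hρ.1 hY k :=
  mul_nonneg (hρ.eigenvalues_nonneg _) (Complex.normSq_nonneg _)

lemma sum_pairWeight {ρ Y : Matrix X X ℂ} (hρ : ρ.IsHermitian) (hY : Y.IsHermitian) :
    ∑ k, pairWeight hρ hY k = (ρ.trace).re := by
  rw [Fintype.sum_prod_type, ← sum_eigenWeight ρ hY]
  exact Finset.sum_congr rfl fun j _ => (eigenWeight_eq_sum hρ hY j).symm

/-- The weights r_i |⟨y_j, r_i⟩|² turn a noncommuting pair into a classical one: the relative
entropy is the mean of −log(y_j / r_i), as for the spectral measure of the relative modular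
operator. Pairs with r_i = 0 carry no weight, so `ρ` may be singular. -/
lemma relEntropy_eq_sum {ρ Y : Matrix X X ℂ} (hρ : ρ.PosSemidef) (hY : Y.PosDef) :
    relEntropy ρ Y = -∑ k, pairWeight hρ.1 hY.1 k * Real.log (pairRatio hρ.1 hY.1 k) := by
  have h1 : ((ρ * cfc Real.log ρ).trace).re
      = ∑ k, pairWeight hρ.1 hY.1 k * Real.log (hρ.1.eigenvalues k.2) := by
    rw [trace_mul_cfc ρ hρ.1, Fintype.sum_prod_type_right]
    refine Finset.sum_congr rfl fun i _ => ?_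
    dsimp only
    rw [eigenWeight_self, ← Finset.sum_mul]
    simp only [pairWeight]
    rw [← Finset.mul_sum, sum_normSq_overlap, mul_one]
  have h2 : ((ρ * cfc Real.log Y).trace).re
      = ∑ k, pairWeight hρ.1 hY.1 k * Real.log (hY.1.eigenvalues k.1) := by
    rw [trace_mul_cfc ρ hY.1, Fintype.sum_prod_type]
    refine Finset.sum_congr rfl fun i _ => ?_
    dsimp only
    rw [eigenWeight_eq_sum hρ.1, ← Finset.sum_mul]
  rw [relEntropy, h1, h2, ← Finset.sum_sub_distrib, ← Finset.sum_neg_distrib]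
  refine Finset.sum_congr rfl fun k _ => ?_
  by_cases hk : pairWeight hρ.1 hY.1 k = 0
  · simp [hk]
  · rw [pairRatio, Real.log_div (hY.eigenvalues_pos _).ne' (pairWeight_ne_zero hρ hY k hk).ne']
    ring

/-- The functional whose supremum over `Z` is the resolvent sum of the pair `(ρ, Y)`. -/
def quadFun (ρ Y : Matrix X X ℂ) (t : ℝ) (Z : Matrix X X ℂ) : ℝ :=
  2 * ((ρ * Z).trace).re - ((Zᴴ * Y * Z).trace).re - t * ((Z * ρ * Zᴴ).trace).re

lemma quadFun_add (ρ₁ ρ₂ Y₁ Y₂ : Matrix X X ℂ) (t : ℝ) (Z : Matrix X X ℂ) :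
    quadFun (ρ₁ + ρ₂) (Y₁ + Y₂) t Z = quadFun ρ₁ Y₁ t Z + quadFun ρ₂ Y₂ t Z := by
  simp only [quadFun, Matrix.add_mul, Matrix.mul_add, Matrix.trace_add, Complex.add_re]
  ring

/-- Written in the eigenbasis of `Y` on the left and of `ρ` on the right, the quadratic form
decouples over the entries, so its supremum can be computed entry by entry. -/
lemma quadFun_eq_sum {ρ Y : Matrix X X ℂ} (hρ : ρ.IsHermitian) (hY : Y.IsHermitian) (t : ℝ)
    (N : Matrix X X ℂ) :
    quadFun ρ Y t (hY.eigenvectorUnitary * N * star (hρ.eigenvectorUnitary : Matrix X X ℂ)) =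
      ∑ k : X × X, (2 * hρ.eigenvalues k.2 * ((N k.1 k.2) * star
        ((star (hY.eigenvectorUnitary : Matrix X X ℂ) * hρ.eigenvectorUnitary) k.1 k.2)).re
        - (hY.eigenvalues k.1 + t * hρ.eigenvalues k.2) * Complex.normSq (N k.1 k.2)) := by
  set U := (hY.eigenvectorUnitary : Matrix X X ℂ) with hU
  set V := (hρ.eigenvectorUnitary : Matrix X X ℂ) with hV
  have hUU : star U * U = 1 := Unitary.coe_star_mul_self hY.eigenvectorUnitary
  have hVV : star V * V = 1 := Unitary.coe_star_mul_self hρ.eigenvectorUnitary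
  set P : Matrix X X ℂ := Matrix.diagonal (fun j => (hρ.eigenvalues j : ℂ)) with hP
  set Q : Matrix X X ℂ := Matrix.diagonal (fun j => (hY.eigenvalues j : ℂ)) with hQ
  have hρV : ρ = V * P * star V := by
    conv_lhs => rw [← cfc_id ℝ ρ hρ.isSelfAdjoint]
    exact cfc_eq_conj hρ id
  have hYU : Y = U * Q * star U := by
    conv_lhs => rw [← cfc_id ℝ Y hY.isSelfAdjoint]
    exact cfc_eq_conj hY id
  have h1 : (ρ * (U * N * star V)).trace = (N * P * star (star U * V)).trace := by
    rw [hρV, Matrix.trace_mul_comm]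
    have : U * N * star V * (V * P * star V) = U * (N * P * star V) := by
      simp only [Matrix.mul_assoc]
      rw [← Matrix.mul_assoc (star V) V, hVV, Matrix.one_mul]
    rw [this, Matrix.trace_mul_comm, star_mul, star_star]
    simp only [Matrix.mul_assoc]
  have h2 : ((U * N * star V)ᴴ * Y * (U * N * star V)).trace = (star N * (Q * N)).trace := by
    rw [← Matrix.star_eq_conjTranspose, star_mul, star_mul, star_star]
    have : V * (star N * star U) * Y * (U * N * star V) = V * (star N * (Q * N) * star V) := by
      rw [hYU]
      simp only [Matrix.mul_assoc]
      rw [← Matrix.mul_assoc (star U) U, ← Matrix.mul_assoc (star U) U, hUU, Matrix.one_mul,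
        Matrix.one_mul]
    rw [this, Matrix.trace_mul_comm, Matrix.mul_assoc, hVV, Matrix.mul_one]
  have h3 : ((U * N * star V) * ρ * (U * N * star V)ᴴ).trace = (N * P * star N).trace := by
    rw [← Matrix.star_eq_conjTranspose, star_mul, star_mul, star_star]
    have : (U * N * star V) * ρ * (V * (star N * star U)) = U * (N * P * star N * star U) := by
      rw [hρV]
      simp only [Matrix.mul_assoc]
      rw [← Matrix.mul_assoc (star V) V, ← Matrix.mul_assoc (star V) V, hVV, Matrix.one_mul,
        Matrix.one_mul]
    rw [this, Matrix.trace_mul_comm, Matrix.mul_assoc, hUU, Matrix.mul_one]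
  have e1 : ((N * P * star (star U * V)).trace).re = ∑ k : X × X,
      hρ.eigenvalues k.2 * ((N k.1 k.2) * star ((star U * V) k.1 k.2)).re := by
    rw [Matrix.trace, Fintype.sum_prod_type, Complex.re_sum]
    refine Finset.sum_congr rfl fun j _ => ?_
    rw [Matrix.diag_apply, Matrix.mul_apply, Complex.re_sum]
    refine Finset.sum_congr rfl fun i _ => ?_
    rw [hP, Matrix.mul_diagonal, Matrix.star_apply, mul_comm _ (hρ.eigenvalues i : ℂ), mul_assoc,
      Complex.re_ofReal_mul]
  have e2 : ((star N * (Q * N)).trace).re = ∑ k : X × X,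
      hY.eigenvalues k.1 * Complex.normSq (N k.1 k.2) := by
    rw [Matrix.trace, Fintype.sum_prod_type_right, Complex.re_sum]
    refine Finset.sum_congr rfl fun j _ => ?_
    rw [Matrix.diag_apply, Matrix.mul_apply, Complex.re_sum]
    refine Finset.sum_congr rfl fun i _ => ?_
    rw [hQ, Matrix.diagonal_mul, Matrix.star_apply, mul_left_comm, mul_comm (star _),
      Complex.star_def, Complex.mul_conj, ← Complex.ofReal_mul, Complex.ofReal_re]
  have e3 : ((N * P * star N).trace).re = ∑ k : X × X,
      hρ.eigenvalues k.2 * Complex.normSq (N k.1 k.2) := by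
    rw [Matrix.trace, Fintype.sum_prod_type, Complex.re_sum]
    refine Finset.sum_congr rfl fun j _ => ?_
    rw [Matrix.diag_apply, Matrix.mul_apply, Complex.re_sum]
    refine Finset.sum_congr rfl fun i _ => ?_
    rw [hP, Matrix.mul_diagonal, Matrix.star_apply, mul_comm _ (hρ.eigenvalues i : ℂ), mul_assoc,
      Complex.star_def, Complex.mul_conj, ← Complex.ofReal_mul, Complex.ofReal_re]
  rw [quadFun, h1, h2, h3, e1, e2, e3, Finset.mul_sum, Finset.mul_sum, ← Finset.sum_sub_distrib,
    ← Finset.sum_sub_distrib]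
  refine Finset.sum_congr rfl fun k _ => ?_
  ring

/-- Completing the square; the maximum is attained at z = (p / a) m. -/
lemma quad_term_le (p a : ℝ) (ha : 0 < a) (m z : ℂ) :
    2 * p * (z * star m).re - a * Complex.normSq z ≤ p ^ 2 * Complex.normSq m / a := by
  rw [le_div_iff₀ ha]
  simp only [Complex.star_def, Complex.mul_re, Complex.conj_re, Complex.conj_im, Complex.normSq_apply]
  nlinarith [sq_nonneg (a * z.re - p * m.re), sq_nonneg (a * z.im - p * m.im)]

lemma quad_term_eq (p a : ℝ) (ha : 0 < a) (m : ℂ) :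
    2 * p * (((p / a : ℝ) : ℂ) * m * star m).re - a * Complex.normSq (((p / a : ℝ) : ℂ) * m)
      = p ^ 2 * Complex.normSq m / a := by
  rw [mul_assoc ((p / a : ℝ) : ℂ), Complex.star_def, Complex.mul_conj, ← Complex.ofReal_mul, Complex.ofReal_re,
    Complex.normSq_mul, Complex.normSq_ofReal]
  field_simp
  ring

lemma pairWeight_div_eq {ρ Y : Matrix X X ℂ} (hρ : ρ.PosSemidef) (hY : Y.PosDef) {t : ℝ}
    (ht : 0 < t) (k : X × X) :
    pairWeight hρ.1 hY.1 k / (pairRatio hρ.1 hY.1 k + t) =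
      hρ.1.eigenvalues k.2 ^ 2 * Complex.normSq
        ((star (hY.1.eigenvectorUnitary : Matrix X X ℂ) * hρ.1.eigenvectorUnitary) k.1 k.2)
        / (hY.1.eigenvalues k.1 + t * hρ.1.eigenvalues k.2) := by
  rw [pairWeight, pairRatio]
  rcases (hρ.eigenvalues_nonneg k.2).eq_or_lt with h | h
  · simp [← h]
  · have := hY.eigenvalues_pos k.1
    field_simp

lemma quadFun_le {ρ Y : Matrix X X ℂ} (hρ : ρ.PosSemidef) (hY : Y.PosDef) {t : ℝ} (ht : 0 < t)
    (Z : Matrix X X ℂ) :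
    quadFun ρ Y t Z ≤ ∑ k, pairWeight hρ.1 hY.1 k / (pairRatio hρ.1 hY.1 k + t) := by
  set U := (hY.1.eigenvectorUnitary : Matrix X X ℂ) with hU
  set V := (hρ.1.eigenvectorUnitary : Matrix X X ℂ) with hV
  have hUU' : U * star U = 1 := Unitary.coe_mul_star_self hY.1.eigenvectorUnitary
  have hVV' : V * star V = 1 := Unitary.coe_mul_star_self hρ.1.eigenvectorUnitary
  have hZ : Z = U * (star U * Z * V) * star V := by
    simp only [Matrix.mul_assoc, hVV', Matrix.mul_one]
    rw [← Matrix.mul_assoc, hUU', Matrix.one_mul]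
  rw [hZ, quadFun_eq_sum]
  refine Finset.sum_le_sum fun k _ => ?_
  rw [pairWeight_div_eq hρ hY ht]
  refine quad_term_le _ _ ?_ _ _
  have := hY.eigenvalues_pos k.1
  have := hρ.eigenvalues_nonneg k.2
  positivity

lemma exists_quadFun_eq {ρ Y : Matrix X X ℂ} (hρ : ρ.PosSemidef) (hY : Y.PosDef) {t : ℝ}
    (ht : 0 < t) :
    ∃ Z, quadFun ρ Y t Z = ∑ k, pairWeight hρ.1 hY.1 k / (pairRatio hρ.1 hY.1 k + t) := by
  refine ⟨_, (quadFun_eq_sum hρ.1 hY.1 t (Matrix.of fun j i =>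
    ((hρ.1.eigenvalues i / (hY.1.eigenvalues j + t * hρ.1.eigenvalues i) : ℝ) : ℂ) *
      (star (hY.1.eigenvectorUnitary : Matrix X X ℂ) * hρ.1.eigenvectorUnitary) j i)).trans ?_⟩
  refine Finset.sum_congr rfl fun k _ => ?_
  rw [pairWeight_div_eq hρ hY ht]
  refine quad_term_eq _ _ ?_ _
  have := hY.eigenvalues_pos k.1
  have := hρ.eigenvalues_nonneg k.2
  positivity

/-- Joint subadditivity of the relative entropy. -/
lemma relEntropy_add_le {ρ₁ ρ₂ Y₁ Y₂ : Matrix X X ℂ} (hρ₁ : ρ₁.PosSemidef) (hρ₂ : ρ₂.PosSemidef)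
    (hY₁ : Y₁.PosDef) (hY₂ : Y₂.PosDef) :
    relEntropy (ρ₁ + ρ₂) (Y₁ + Y₂) ≤ relEntropy ρ₁ Y₁ + relEntropy ρ₂ Y₂ := by
  have hρ := hρ₁.add hρ₂
  have hY := hY₁.add hY₂
  have key := sum_mul_log_le_of_sum_div_le (pairWeight hρ.1 hY.1) (pairRatio hρ.1 hY.1)
    (Sum.elim (pairWeight hρ₁.1 hY₁.1) (pairWeight hρ₂.1 hY₂.1))
    (Sum.elim (pairRatio hρ₁.1 hY₁.1) (pairRatio hρ₂.1 hY₂.1))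
    (fun k => pairRatio_pos hρ hY k)
    (by rintro (k | k) hk
        · exact pairRatio_pos hρ₁ hY₁ k hk
        · exact pairRatio_pos hρ₂ hY₂ k hk)
    (by simp [Fintype.sum_sum_type, sum_pairWeight, Matrix.trace_add])
    (by intro t ht
        -- `quadFun` is additive in the pair, and the `Z` optimal for the sum is merely a competitor
        -- for each summand. So the resolvent sums are subadditive, and the comparison principle
        -- passes this on to the logarithms.
        obtain ⟨Z, hZ⟩ := exists_quadFun_eq hρ hY ht
        rw [← hZ, quadFun_add, Fintype.sum_sum_type]
        exact add_le_add (quadFun_le hρ₁ hY₁ ht Z) (quadFun_le hρ₂ hY₂ ht Z))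
  rw [Fintype.sum_sum_type] at key
  simp only [Sum.elim_inl, Sum.elim_inr] at key
  rw [relEntropy_eq_sum hρ hY, relEntropy_eq_sum hρ₁ hY₁, relEntropy_eq_sum hρ₂ hY₂]
  linarith

/-- Klein's inequality. -/
lemma trace_sub_trace_le_relEntropy {ρ Y : Matrix X X ℂ} (hρ : ρ.PosSemidef) (hY : Y.PosDef) :
    (ρ.trace).re - (Y.trace).re ≤ relEntropy ρ Y := by
  rw [relEntropy_eq_sum hρ hY, ← sum_pairWeight hρ.1 hY.1]
  have hYt : (Y.trace).re = ∑ k : X × X, hY.1.eigenvalues k.1 * Complex.normSq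
      ((star (hY.1.eigenvectorUnitary : Matrix X X ℂ) * hρ.1.eigenvectorUnitary) k.1 k.2) := by
    rw [Fintype.sum_prod_type, ← sum_eigenWeight Y hY.1]
    refine Finset.sum_congr rfl fun j _ => ?_
    dsimp only
    rw [eigenWeight_self, ← Finset.mul_sum, overlap_sum_left, mul_one]
  rw [hYt, ← Finset.sum_sub_distrib, ← Finset.sum_neg_distrib]
  refine Finset.sum_le_sum fun k _ => ?_
  have hy := hY.eigenvalues_pos k.1
  have hn := Complex.normSq_nonneg
      ((star (hY.1.eigenvectorUnitary : Matrix X X ℂ) * hρ.1.eigenvectorUnitary) k.1 k.2)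
  by_cases hk : pairWeight hρ.1 hY.1 k = 0
  · rw [hk]
    have := mul_nonneg hy.le hn
    linarith
  · have hp := pairWeight_ne_zero hρ hY k hk
    have h1 := Real.log_le_sub_one_of_pos (pairRatio_pos hρ hY k hk)
    have h2 := mul_le_mul_of_nonneg_left h1 (pairWeight_nonneg hρ hY.1 k)
    have h3 : pairWeight hρ.1 hY.1 k * (pairRatio hρ.1 hY.1 k - 1) =
        hY.1.eigenvalues k.1 * Complex.normSq ((star (hY.1.eigenvectorUnitary : Matrix X X ℂ) *
          hρ.1.eigenvectorUnitary) k.1 k.2) - pairWeight hρ.1 hY.1 k := by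
      rw [pairWeight, pairRatio]
      field_simp
    linarith

end RelEntropy

/-! ### Scaling and shifts inside the logarithm, and a tangent bound for the inverse -/

section Log

variable {X : Type*} [Fintype X] [DecidableEq X]

lemma cfc_log_smul_eq {Y : Matrix X X ℂ} (hY : Y.IsHermitian) (c : ℝ) :
    cfc Real.log (c • Y) = cfc (fun x => Real.log (c * x)) Y := by
  have h1 : c • Y = cfc (fun x : ℝ => c * x) Y := by
    rw [cfc_const_mul c (fun x => x) Y (continuousOn_spectrum _ _), cfc_id' ℝ Y hY.isSelfAdjoint]
  conv_lhs => rw [h1]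
  exact (cfc_comp' Real.log (fun x => c * x) Y (Set.Finite.continuousOn (Y.finite_real_spectrum.image _) _)
    (continuousOn_spectrum _ _) hY.isSelfAdjoint).symm

lemma trace_mul_log_smul (ω : Matrix X X ℂ) {Y : Matrix X X ℂ} (hY : Y.PosDef) {c : ℝ}
    (hc : 0 < c) : ((ω * cfc Real.log (c • Y)).trace).re
      = Real.log c * (ω.trace).re + ((ω * cfc Real.log Y).trace).re := by
  rw [cfc_log_smul_eq hY.1, trace_mul_cfc ω hY.1, trace_mul_cfc ω hY.1, ← sum_eigenWeight ω hY.1,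
    Finset.mul_sum, ← Finset.sum_add_distrib]
  refine Finset.sum_congr rfl fun j _ => ?_
  rw [Real.log_mul hc.ne' (hY.eigenvalues_pos j).ne']
  ring

lemma trace_mul_log_smul_self {ρ : Matrix X X ℂ} (hρ : ρ.IsHermitian) {c : ℝ}
    (hc : 0 < c) : ((ρ * cfc Real.log (c • ρ)).trace).re
      = Real.log c * (ρ.trace).re + ((ρ * cfc Real.log ρ).trace).re := by
  rw [cfc_log_smul_eq hρ, trace_mul_cfc ρ hρ, trace_mul_cfc ρ hρ, ← sum_eigenWeight ρ hρ,
    Finset.mul_sum, ← Finset.sum_add_distrib]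
  refine Finset.sum_congr rfl fun j _ => ?_
  rw [eigenWeight_self]
  by_cases h : hρ.eigenvalues j = 0
  · simp [h]
  · rw [Real.log_mul hc.ne' h]
    ring

lemma relEntropy_smul {ρ Y : Matrix X X ℂ} (hρ : ρ.IsHermitian) (hY : Y.PosDef) {c : ℝ}
    (hc : 0 < c) : relEntropy (c • ρ) (c • Y) = c * relEntropy ρ Y := by
  simp only [relEntropy, Matrix.smul_mul, Matrix.trace_smul, Complex.smul_re, smul_eq_mul,
    trace_mul_log_smul_self hρ hc, trace_mul_log_smul ρ hY hc]
  ring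

/-- A singular `ρ` is allowed, since the eigenvalue 0 has weight 0. This compares the regularized
marginals with the entropies of the true ones. -/
lemma trace_mul_log_add_one_ge {ρ : Matrix X X ℂ} (hρ : ρ.PosSemidef) {c d : ℝ}
    (hc : 0 < c) (hd : 0 < d) : Real.log c * (ρ.trace).re + ((ρ * cfc Real.log ρ).trace).re
      ≤ ((ρ * cfc Real.log (c • ρ + d • (1 : Matrix X X ℂ))).trace).re := by
  have hsa := hρ.1.isSelfAdjoint
  have h1 : c • ρ + d • (1 : Matrix X X ℂ) = cfc (fun x : ℝ => c * x + d) ρ := by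
    rw [cfc_add_const d (fun x => c * x) ρ (continuousOn_spectrum _ _) hsa,
      cfc_const_mul c (fun x => x) ρ (continuousOn_spectrum _ _), cfc_id' ℝ ρ,
      Algebra.algebraMap_eq_smul_one]
  rw [h1, ← cfc_comp' Real.log (fun x => c * x + d) ρ
    (Set.Finite.continuousOn (ρ.finite_real_spectrum.image _) _) (continuousOn_spectrum _ _) hsa,
    trace_mul_cfc ρ hρ.1, trace_mul_cfc ρ hρ.1, ← sum_eigenWeight ρ hρ.1,
    Finset.mul_sum, ← Finset.sum_add_distrib]
  refine Finset.sum_le_sum fun j _ => ?_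
  rw [eigenWeight_self]
  rcases (hρ.eigenvalues_nonneg j).eq_or_lt with h | h
  · simp [← h]
  · rw [mul_comm (Real.log c), ← mul_add, ← Real.log_mul hc.ne' h.ne']
    exact mul_le_mul_of_nonneg_left (Real.log_le_log (by positivity) (by linarith)) h.le

lemma posDef_of_smul_one_le {T : Matrix X X ℂ} {δ : ℝ} (hδ : 0 < δ)
    (h : δ • (1 : Matrix X X ℂ) ≤ T) : T.PosDef := by
  have h1 : (δ • (1 : Matrix X X ℂ)).PosDef := Matrix.PosDef.one.smul hδ
  have := h1.add_posSemidef (Matrix.le_iff.1 h)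
  simpa using this

/-- The tangent bound for the resolvent: `2 Z - Z T Z ≤ T⁻¹`. -/
lemma two_smul_sub_le_inv {T Z : Matrix X X ℂ} (hT : T.PosDef) (hZ : Z.IsHermitian) :
    (2 : ℝ) • Z - Z * T * Z ≤ T⁻¹ := by
  have h1 : ((T⁻¹ - Z)ᴴ * T * (T⁻¹ - Z)).PosSemidef := hT.posSemidef.conjTranspose_mul_mul_same _
  have hdet : IsUnit T.det := (Matrix.isUnit_iff_isUnit_det T).1 hT.isUnit
  have h2 : (T⁻¹ - Z)ᴴ * T * (T⁻¹ - Z) = T⁻¹ - ((2 : ℝ) • Z - Z * T * Z) := by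
    rw [Matrix.conjTranspose_sub, hZ.eq, hT.1.inv.eq, Matrix.sub_mul, Matrix.nonsing_inv_mul _ hdet,
      Matrix.sub_mul, Matrix.mul_sub, Matrix.mul_sub, Matrix.one_mul, Matrix.one_mul,
      Matrix.mul_assoc Z T T⁻¹, Matrix.mul_nonsing_inv _ hdet, Matrix.mul_one, two_smul]
    abel
  rw [Matrix.le_iff, ← h2]
  exact h1

end Log

/-! ### Slices by a state, and the Lieb-type lower bound for the mutual information -/

section Slice

variable {A B : Type*} [Fintype A] [Fintype B] [DecidableEq A] [DecidableEq B]

/-- The map `T ↦ tr_B ((1 ⊗ ω) T)`. -/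
def sliceMap (ω : Matrix B B ℂ) (T : Matrix (A × B) (A × B) ℂ) : Matrix A A ℂ :=
  Matrix.of fun a a' => ∑ b, ∑ b', ω b' b * T (a, b) (a', b')

lemma trace_kronecker_mul (α : Matrix A A ℂ) (ω : Matrix B B ℂ)
    (T : Matrix (A × B) (A × B) ℂ) : ((α ⊗ₖ ω) * T).trace = (α * sliceMap ω T).trace := by
  simp only [Matrix.trace, Matrix.diag, Matrix.mul_apply, Fintype.sum_prod_type, sliceMap,
    Matrix.of_apply, Matrix.kronecker_apply, Finset.mul_sum]
  refine Finset.sum_congr rfl fun a _ => ?_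
  rw [Finset.sum_comm]
  refine Finset.sum_congr rfl fun a' _ => ?_
  rw [Finset.sum_comm]
  refine Finset.sum_congr rfl fun b _ => Finset.sum_congr rfl fun b' _ => ?_
  ring

lemma sliceMap_add (ω : Matrix B B ℂ) (S T : Matrix (A × B) (A × B) ℂ) :
    sliceMap ω (S + T) = sliceMap ω S + sliceMap ω T := by
  ext a a'
  simp [sliceMap, mul_add, Finset.sum_add_distrib]

lemma sliceMap_sub (ω : Matrix B B ℂ) (S T : Matrix (A × B) (A × B) ℂ) :
    sliceMap ω (S - T) = sliceMap ω S - sliceMap ω T := by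
  ext a a'
  simp [sliceMap, mul_sub, Finset.sum_sub_distrib]

lemma sliceMap_smul (ω : Matrix B B ℂ) (c : ℝ) (T : Matrix (A × B) (A × B) ℂ) :
    sliceMap ω (c • T) = c • sliceMap ω T := by
  ext a a'
  simp only [sliceMap, Matrix.of_apply, Matrix.smul_apply, Finset.smul_sum, mul_smul_comm]

lemma sliceMap_sum {ι : Type*} (s : Finset ι) (ω : Matrix B B ℂ)
    (T : ι → Matrix (A × B) (A × B) ℂ) :
    sliceMap ω (∑ i ∈ s, T i) = ∑ i ∈ s, sliceMap ω (T i) := by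
  classical
  induction s using Finset.induction_on with
  | empty => ext a a'; simp [sliceMap]
  | insert i s hi ih => rw [Finset.sum_insert hi, Finset.sum_insert hi, sliceMap_add, ih]

lemma sliceMap_add_left (ω τ : Matrix B B ℂ) (T : Matrix (A × B) (A × B) ℂ) :
    sliceMap (ω + τ) T = sliceMap ω T + sliceMap τ T := by
  ext a a'
  simp [sliceMap, add_mul, Finset.sum_add_distrib]

lemma sliceMap_smul_left (c : ℝ) (ω : Matrix B B ℂ) (T : Matrix (A × B) (A × B) ℂ) :
    sliceMap (c • ω) T = c • sliceMap ω T := by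
  ext a a'
  simp only [sliceMap, Matrix.of_apply, Matrix.smul_apply, Finset.smul_sum, smul_mul_assoc]

lemma sliceMap_kronecker (ω : Matrix B B ℂ) (M : Matrix A A ℂ) (N : Matrix B B ℂ) :
    sliceMap ω (M ⊗ₖ N) = (ω * N).trace • M := by
  ext a a'
  simp only [sliceMap, Matrix.of_apply, Matrix.kronecker_apply, Matrix.smul_apply, smul_eq_mul,
    Matrix.trace, Matrix.diag, Matrix.mul_apply, Finset.sum_mul]
  rw [Finset.sum_comm]
  refine Finset.sum_congr rfl fun b _ => Finset.sum_congr rfl fun b' _ => ?_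
  ring

lemma sliceMap_kronecker_one {ω : Matrix B B ℂ} (hω : ω.trace = 1) (M : Matrix A A ℂ) :
    sliceMap ω (M ⊗ₖ (1 : Matrix B B ℂ)) = M := by
  rw [sliceMap_kronecker, Matrix.mul_one, hω, one_smul]

lemma sliceMap_one {ω : Matrix B B ℂ} (hω : ω.trace = 1) :
    sliceMap ω (1 : Matrix (A × B) (A × B) ℂ) = 1 := by
  rw [← Matrix.one_kronecker_one, sliceMap_kronecker_one hω]

lemma trace_mul_nonneg_complex {X : Type*} [Fintype X] {P Q : Matrix X X ℂ}
    (hP : P.PosSemidef) (hQ : Q.PosSemidef) : 0 ≤ (P * Q).trace := by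
  classical
  obtain ⟨S, rfl⟩ := CStarAlgebra.nonneg_iff_eq_star_mul_self.mp (Matrix.nonneg_iff_posSemidef.2 hP)
  rw [Matrix.mul_assoc, Matrix.trace_mul_comm]
  exact (hQ.mul_mul_conjTranspose_same S).trace_nonneg

lemma sliceMap_posSemidef {ω : Matrix B B ℂ} (hω : ω.PosSemidef)
    {T : Matrix (A × B) (A × B) ℂ} (hT : T.PosSemidef) : (sliceMap ω T).PosSemidef := by
  refine Matrix.PosSemidef.of_dotProduct_mulVec_nonneg ?_ fun v => ?_
  · refine Matrix.IsHermitian.ext fun a a' => ?_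
    simp only [sliceMap, Matrix.of_apply, star_sum, star_mul', hω.1.apply, hT.1.apply]
    exact Finset.sum_comm
  · have h1 : star v ⬝ᵥ (sliceMap ω T *ᵥ v)
        = (Matrix.vecMulVec v (star v) * sliceMap ω T).trace := by
      rw [Matrix.trace_mul_comm, Matrix.mul_vecMulVec, Matrix.trace_vecMulVec, dotProduct_comm]
    rw [h1, ← trace_kronecker_mul]
    exact trace_mul_nonneg_complex ((Matrix.posSemidef_vecMulVec_self_star v).kronecker hω) hT

lemma sliceMap_mono {ω : Matrix B B ℂ} (hω : ω.PosSemidef)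
    {S T : Matrix (A × B) (A × B) ℂ} (h : S ≤ T) : sliceMap ω S ≤ sliceMap ω T := by
  rw [Matrix.le_iff, ← sliceMap_sub]
  exact sliceMap_posSemidef hω (Matrix.le_iff.1 h)

/-- The operator Jensen inequality for the logarithm and the unital map `sliceMap ω`. -/
lemma trace_kronecker_mul_log_le {α : Matrix A A ℂ} (hα : α.PosSemidef) {ω : Matrix B B ℂ}
    (hω : IsDensity ω) {T : Matrix (A × B) (A × B) ℂ} (hT : T.PosDef)
    (hX : (sliceMap ω T).PosDef) :
    (((α ⊗ₖ ω) * cfc Real.log T).trace).re ≤ ((α * cfc Real.log (sliceMap ω T)).trace).re := by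
  have hσ := hα.kronecker hω.1
  rw [trace_mul_cfc _ hT.1, trace_mul_cfc _ hX.1]
  refine sum_mul_log_le_of_sum_div_le _ _ _ _ (fun j _ => hX.eigenvalues_pos j)
    (fun j _ => hT.eigenvalues_pos j) ?_ fun t ht => ?_
  · rw [sum_eigenWeight, sum_eigenWeight, Matrix.trace_kronecker, hω.2, mul_one]
  · rw [← trace_mul_inv_add_smul _ hX ht.le, ← trace_mul_inv_add_smul _ hT ht.le]
    have ht1 : (t • (1 : Matrix A A ℂ)).PosSemidef := Matrix.PosSemidef.one.smul ht.le
    have ht2 : (t • (1 : Matrix (A × B) (A × B) ℂ)).PosSemidef := Matrix.PosSemidef.one.smul ht.le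
    have hXt := hX.add_posSemidef ht1
    have hTt := hT.add_posSemidef ht2
    -- The tangent bound for the resolvent of `T`, taken at `Z ⊗ₖ 1`: after slicing, both 2Z and Z(X
    -- + t)Z reduce to multiples of Z, and what is left is exactly the resolvent of the slice.
    set Z := (sliceMap ω T + t • (1 : Matrix A A ℂ))⁻¹ with hZ
    have hdet := (Matrix.isUnit_iff_isUnit_det _).1 hXt.isUnit
    have hZh : Z.IsHermitian := hXt.1.inv
    have hZ1 : (Z ⊗ₖ (1 : Matrix B B ℂ)).IsHermitian := by
      unfold Matrix.IsHermitian
      rw [Matrix.conjTranspose_kronecker, hZh.eq, Matrix.conjTranspose_one]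
    refine le_trans (le_of_eq ?_) (trace_mul_le hσ (two_smul_sub_le_inv hTt hZ1))
    have e1 : ((α ⊗ₖ ω) * (Z ⊗ₖ (1 : Matrix B B ℂ))).trace = (α * Z).trace := by
      rw [trace_kronecker_mul, sliceMap_kronecker_one hω.2]
    have e2 : ((α ⊗ₖ ω) * (Z ⊗ₖ (1 : Matrix B B ℂ) * (T + t • 1) * (Z ⊗ₖ (1 : Matrix B B ℂ)))).trace
        = (α * Z).trace := by
      have : ((α ⊗ₖ ω) * (Z ⊗ₖ (1 : Matrix B B ℂ) * (T + t • 1) * (Z ⊗ₖ (1 : Matrix B B ℂ)))).trace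
          = (((Z * (α * Z)) ⊗ₖ ω) * (T + t • 1)).trace := by
        rw [← Matrix.mul_assoc, Matrix.trace_mul_comm, ← Matrix.mul_assoc, ← Matrix.mul_assoc,
          Matrix.mul_assoc (Z ⊗ₖ (1 : Matrix B B ℂ)), ← Matrix.mul_kronecker_mul,
          ← Matrix.mul_kronecker_mul, Matrix.one_mul, Matrix.mul_one]
      rw [this, trace_kronecker_mul, sliceMap_add, sliceMap_smul, sliceMap_one hω.2,
        Matrix.mul_assoc, Matrix.trace_mul_comm, Matrix.mul_assoc, Matrix.mul_nonsing_inv _ hdet, Matrix.mul_one]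
    rw [Matrix.mul_sub, Matrix.trace_sub, Complex.sub_re, e2, Matrix.mul_smul, Matrix.trace_smul,
      e1, Complex.smul_re, smul_eq_mul]
    ring

lemma trace_mul_kronecker_one (ρ : Matrix (A × B) (A × B) ℂ) (M : Matrix A A ℂ) :
    (ρ * (M ⊗ₖ (1 : Matrix B B ℂ))).trace = (reduceFst ρ * M).trace := by
  simp only [Matrix.trace, Matrix.diag, Matrix.mul_apply, Fintype.sum_prod_type, reduceFst,
    Matrix.of_apply, Matrix.kronecker_apply, Matrix.one_apply, Finset.sum_mul, mul_ite, mul_one,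
    mul_zero, Finset.sum_ite_eq', Finset.mem_univ, if_true]
  exact Finset.sum_congr rfl fun a _ => Finset.sum_comm

lemma trace_mul_one_kronecker (ρ : Matrix (A × B) (A × B) ℂ) (M : Matrix B B ℂ) :
    (ρ * ((1 : Matrix A A ℂ) ⊗ₖ M)).trace = (reduceSnd ρ * M).trace := by
  simp only [Matrix.trace, Matrix.diag, Matrix.mul_apply, Fintype.sum_prod_type, reduceSnd,
    Matrix.of_apply, Matrix.kronecker_apply, Matrix.one_apply, Finset.sum_mul, ite_mul, one_mul,
    zero_mul, mul_ite, mul_zero]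
  rw [Finset.sum_comm]
  refine Finset.sum_congr rfl fun b _ => ?_
  conv_rhs => rw [Finset.sum_comm]
  refine Finset.sum_congr rfl fun a _ => ?_
  rw [Finset.sum_comm]
  simp

lemma reduceFst_eq_sum (ρ : Matrix (A × B) (A × B) ℂ) :
    reduceFst ρ = ∑ y, ρ.submatrix (fun x => (x, y)) (fun x => (x, y)) := by
  ext a a'
  simp [reduceFst, Matrix.sum_apply]

lemma reduceSnd_eq_sum (ρ : Matrix (A × B) (A × B) ℂ) :
    reduceSnd ρ = ∑ x, ρ.submatrix (fun y => (x, y)) (fun y => (x, y)) := by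
  ext a a'
  simp [reduceSnd, Matrix.sum_apply]

lemma IsDensity.reduceFst {ρ : Matrix (A × B) (A × B) ℂ} (hρ : IsDensity ρ) :
    IsDensity (reduceFst ρ) := by
  refine ⟨?_, ?_⟩
  · rw [reduceFst_eq_sum]
    exact Matrix.posSemidef_sum _ fun y _ => hρ.1.submatrix _
  · have := trace_mul_kronecker_one ρ (1 : Matrix A A ℂ)
    rw [Matrix.one_kronecker_one, Matrix.mul_one, Matrix.mul_one, hρ.2] at this
    exact this.symm

lemma IsDensity.reduceSnd {ρ : Matrix (A × B) (A × B) ℂ} (hρ : IsDensity ρ) :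
    IsDensity (reduceSnd ρ) := by
  refine ⟨?_, ?_⟩
  · rw [reduceSnd_eq_sum]
    exact Matrix.posSemidef_sum _ fun y _ => hρ.1.submatrix _
  · have := trace_mul_one_kronecker ρ (1 : Matrix B B ℂ)
    rw [Matrix.one_kronecker_one, Matrix.mul_one, Matrix.mul_one, hρ.2] at this
    exact this.symm

open Filter Topology in
/-- Lieb's three matrix inequality in its variational form, for a positive definite product
state. -/
lemma trace_mul_log_sub_le_of_product {ωA : Matrix A A ℂ} {ωB : Matrix B B ℂ}
    (hA : IsDensity ωA) (hB : IsDensity ωB) (hA' : ωA.PosDef) (hB' : ωB.PosDef)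
    {ρ : Matrix (A × B) (A × B) ℂ} (hρ : IsDensity ρ)
    {T : Matrix (A × B) (A × B) ℂ} (hT : T.PosDef) (hX : (sliceMap ωB T).PosDef)
    {k : ℝ} (hk : 0 ≤ k) (hTk : T ≤ k • (sliceMap ωB T ⊗ₖ (1 : Matrix B B ℂ))) :
    ((ρ * cfc Real.log T).trace).re - ((reduceFst ρ * cfc Real.log (sliceMap ωB T)).trace).re
      ≤ relEntropy ρ (ωA ⊗ₖ ωB) := by
  set X := sliceMap ωB T with hXdef
  set X1 := X ⊗ₖ (1 : Matrix B B ℂ) with hX1def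
  set σ := ωA ⊗ₖ ωB with hσdef
  have hσ : σ.PosDef := hA'.kronecker hB'
  have hσ1 : σ.trace = 1 := by rw [hσdef, Matrix.trace_kronecker, hA.2, hB.2, mul_one]
  have hX1 : X1.PosDef := hX.kronecker Matrix.PosDef.one
  have hlogX1 : cfc Real.log X1 = cfc Real.log X ⊗ₖ (1 : Matrix B B ℂ) :=
    cfc_kronecker_one hX.1 Real.log
  have hρX : ((ρ * cfc Real.log X1).trace).re = ((reduceFst ρ * cfc Real.log X).trace).re := by
    rw [hlogX1, trace_mul_kronecker_one]
  have hσX : ((σ * cfc Real.log X1).trace).re = ((ωA * cfc Real.log X).trace).re := by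
    rw [hlogX1, hσdef, trace_kronecker_mul, sliceMap_kronecker_one hB.2]
  -- Perturb the pair (σ, X ⊗ 1) by θ(ρ, T). In joint subadditivity combined with Klein's inequality
  -- the terms of order zero cancel, and division by θ leaves the claim up to log(1 + θk), which
  -- vanishes as θ tends to 0.
  have key : ∀ θ : ℝ, 0 < θ → ((ρ * cfc Real.log T).trace).re
      - ((reduceFst ρ * cfc Real.log X).trace).re - Real.log (1 + θ * k) ≤ relEntropy ρ σ := by
    intro θ hθ
    have hθT : (θ • T).PosDef := hT.smul hθ
    have hθρ : (θ • ρ).PosSemidef := hρ.1.smul hθ.le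
    have hY := hX1.add hθT
    have hθk : 0 < 1 + θ * k := by positivity
    have h1 := relEntropy_add_le hσ.posSemidef hθρ hX1 hθT
    rw [relEntropy_smul hρ.1.1 hT hθ] at h1
    have h2 := trace_sub_trace_le_relEntropy (hσ.posSemidef.add hθρ) hσ
    have h3 : ((σ * cfc Real.log (X1 + θ • T)).trace).re
        ≤ θ + ((σ * cfc Real.log X1).trace).re := by
      -- Since `X` is itself the slice of `T`, Jensen costs only log(1 + θ) ≤ θ here, which the θ
      -- gained from Klein's inequality in `h2` cancels exactly.
      have e : sliceMap ωB (X1 + θ • T) = (1 + θ) • X := by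
        rw [sliceMap_add, hX1def, sliceMap_kronecker_one hB.2, sliceMap_smul, ← hXdef, add_smul,
          one_smul]
      have h4 := trace_kronecker_mul_log_le hA.1 hB hY
        (by rw [e]; exact hX.smul (by positivity))
      rw [e, trace_mul_log_smul ωA hX (by positivity), hA.2, ← hσX] at h4
      have h5 := Real.log_le_sub_one_of_pos (show 0 < 1 + θ by positivity)
      simp only [Complex.one_re, mul_one] at h4
      linarith
    have h4 : ((ρ * cfc Real.log (X1 + θ • T)).trace).re
        ≤ Real.log (1 + θ * k) + ((ρ * cfc Real.log X1).trace).re := by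
      -- A crude bound is enough, because this term already carries a factor θ.
      have hle : X1 + θ • T ≤ (1 + θ * k) • X1 := by
        rw [add_smul, one_smul, mul_smul]
        exact add_le_add le_rfl (smul_le_smul_of_nonneg_left hTk hθ.le)
      have h5 := trace_mul_log_mono hρ.1 hY hle
      rw [trace_mul_log_smul ρ hX1 hθk, hρ.2] at h5
      simpa using h5
    have h4' := mul_le_mul_of_nonneg_left h4 hθ.le
    simp only [relEntropy, Matrix.add_mul, Matrix.trace_add, Complex.add_re, Matrix.smul_mul,
      Matrix.trace_smul, Complex.smul_re, smul_eq_mul, hσ1, hρ.2, Complex.one_re, mul_one]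
      at h1 h2
    rw [← hρX]
    have h6 : θ * (((ρ * cfc Real.log T).trace).re
        - ((ρ * cfc Real.log X1).trace).re - Real.log (1 + θ * k)) ≤ θ * relEntropy ρ σ := by
      simp only [relEntropy]
      linarith
    exact le_of_mul_le_mul_left h6 hθ
  have hlim : Tendsto (fun θ : ℝ => ((ρ * cfc Real.log T).trace).re
      - ((reduceFst ρ * cfc Real.log X).trace).re - Real.log (1 + θ * k)) (𝓝[>] 0)
      (𝓝 (((ρ * cfc Real.log T).trace).re
      - ((reduceFst ρ * cfc Real.log X).trace).re - Real.log (1 + 0 * k))) := by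
    refine tendsto_nhdsWithin_of_tendsto_nhds (ContinuousAt.tendsto ?_)
    refine continuousAt_const.sub (ContinuousAt.log (by fun_prop) (by norm_num))
  rw [zero_mul, add_zero, Real.log_one, sub_zero] at hlim
  exact le_of_tendsto hlim (eventually_mem_nhdsWithin.mono fun θ hθ => key θ hθ)

/-- The mixture of a state with the maximally mixed one. -/
lemma isDensity_mix {X : Type*} [Fintype X] [DecidableEq X] {ρ : Matrix X X ℂ} (hρ : IsDensity ρ)
    {η : ℝ} (h0 : 0 < η) (h1 : η < 1) :
    let ω := (1 - η) • ρ + (η / Fintype.card X) • (1 : Matrix X X ℂ)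
    0 < η / Fintype.card X ∧ ω.PosDef ∧ IsDensity ω := by
  intro ω
  have hne : Nonempty X := by
    by_contra h
    rw [not_nonempty_iff] at h
    have := hρ.2
    simp [Matrix.trace] at this
  have hc : (0 : ℝ) < Fintype.card X := by exact_mod_cast Fintype.card_pos
  have hd : 0 < η / Fintype.card X := by positivity
  have h2 : ω.PosDef := (Matrix.PosDef.one.smul hd).posSemidef_add (hρ.1.smul (sub_nonneg.2 h1.le))
  refine ⟨hd, h2, h2.posSemidef, ?_⟩
  have hcc : (Fintype.card X : ℂ) ≠ 0 := by exact_mod_cast hc.ne'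
  simp only [ω, Matrix.trace_add, Matrix.trace_smul, hρ.2, Matrix.trace_one, Complex.real_smul]
  push_cast
  field_simp
  ring

open Filter Topology in
/-- Lieb's three matrix inequality as a lower bound for the mutual information. -/
theorem trace_mul_log_sub_le_mutualInfo {ρ : Matrix (A × B) (A × B) ℂ} (hρ : IsDensity ρ)
    {T : Matrix (A × B) (A × B) ℂ} {δ κ : ℝ} (hδ : 0 < δ) (hκ : 0 ≤ κ)
    (hδT : δ • (1 : Matrix (A × B) (A × B) ℂ) ≤ T)
    (hTκ : T ≤ κ • (1 : Matrix (A × B) (A × B) ℂ)) :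
    ((ρ * cfc Real.log T).trace).re
      - ((reduceFst ρ * cfc Real.log (sliceMap (reduceSnd ρ) T)).trace).re ≤ mutualInfo ρ := by
  set X := sliceMap (reduceSnd ρ) T with hXdef
  have hA := hρ.reduceFst
  have hB := hρ.reduceSnd
  have hslice : ∀ {ω : Matrix B B ℂ}, IsDensity ω → δ • (1 : Matrix A A ℂ) ≤ sliceMap ω T := by
    intro ω hω
    have := sliceMap_mono hω.1 hδT
    rwa [sliceMap_smul, sliceMap_one hω.2] at this
  have hT : T.PosDef := posDef_of_smul_one_le hδ hδT
  have hX : X.PosDef := posDef_of_smul_one_le hδ (hslice hB)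
  -- The product inequality needs positive definite marginals, so each is mixed with weight η of the
  -- maximally mixed state. The bounds on `T` let the slice grow by a factor of at most 1 + ηκ/δ,
  -- and each marginal costs log(1 − η). These errors vanish as η tends to 0.
  have key : ∀ η ∈ Set.Ioo (0 : ℝ) 1, ((ρ * cfc Real.log T).trace).re
      - ((reduceFst ρ * cfc Real.log X).trace).re - Real.log (1 + η * (κ / δ))
        + 2 * Real.log (1 - η) ≤ mutualInfo ρ := by
    rintro η ⟨h0, h1⟩
    obtain ⟨hdA, hA', hA''⟩ := isDensity_mix hA h0 h1
    obtain ⟨hdB, hB', hB''⟩ := isDensity_mix hB h0 h1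
    set ωA := (1 - η) • reduceFst ρ + (η / Fintype.card A) • (1 : Matrix A A ℂ) with hωA
    set ωB := (1 - η) • reduceSnd ρ + (η / Fintype.card B) • (1 : Matrix B B ℂ) with hωB
    have hXη : (sliceMap ωB T).PosDef := posDef_of_smul_one_le hδ (hslice hB'')
    have hδ1 : ∀ {Y : Matrix A A ℂ}, δ • (1 : Matrix A A ℂ) ≤ Y →
        κ • (1 : Matrix A A ℂ) ≤ (κ / δ) • Y := by
      intro Y h
      have := smul_le_smul_of_nonneg_left h (show 0 ≤ κ / δ by positivity)
      rwa [smul_smul, div_mul_cancel₀ _ hδ.ne'] at this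
    have hTk : T ≤ (κ / δ) • (sliceMap ωB T ⊗ₖ (1 : Matrix B B ℂ)) := by
      refine hTκ.trans ?_
      rw [← Matrix.smul_kronecker, Matrix.le_iff]
      have h2 := (Matrix.le_iff.1 (hδ1 (hslice hB''))).kronecker
        (Matrix.PosSemidef.one (n := B) (R := ℂ))
      have h3 : ((κ / δ) • sliceMap ωB T - κ • (1 : Matrix A A ℂ)) ⊗ₖ (1 : Matrix B B ℂ)
          = ((κ / δ) • sliceMap ωB T) ⊗ₖ (1 : Matrix B B ℂ)
            - κ • (1 : Matrix (A × B) (A × B) ℂ) := by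
        rw [sub_eq_add_neg, Matrix.add_kronecker, ← neg_smul, Matrix.smul_kronecker (-κ),
          Matrix.one_kronecker_one, neg_smul, ← sub_eq_add_neg]
      rwa [h3] at h2
    have hmain := trace_mul_log_sub_le_of_product hA'' hB'' hA' hB' hρ hT hXη
      (show 0 ≤ κ / δ by positivity) hTk
    have hXle : sliceMap ωB T ≤ (1 + η * (κ / δ)) • X := by
      have e1 : sliceMap ωB T = (1 - η) • X
          + (η / Fintype.card B) • sliceMap (1 : Matrix B B ℂ) T := by
        rw [hωB, sliceMap_add_left, sliceMap_smul_left, sliceMap_smul_left]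
      have hX0 : (0 : Matrix A A ℂ) ≤ X := Matrix.nonneg_iff_posSemidef.2 hX.posSemidef
      have e2 : (1 - η) • X ≤ (1 : ℝ) • X :=
        smul_le_smul_of_nonneg_right (by linarith) hX0
      have e3 : sliceMap (1 : Matrix B B ℂ) T
          ≤ (κ * Fintype.card B) • (1 : Matrix A A ℂ) := by
        have := sliceMap_mono (Matrix.PosSemidef.one (n := B) (R := ℂ)) hTκ
        rw [sliceMap_smul, ← Matrix.one_kronecker_one, sliceMap_kronecker, Matrix.mul_one,
          Matrix.trace_one] at this
        rw [mul_smul]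
        convert this using 2
        ext i j
        simp
      have hcB : (Fintype.card B : ℝ) ≠ 0 := by
        intro h
        rw [h] at hdB
        simp at hdB
      have e4 : (η / Fintype.card B) • sliceMap (1 : Matrix B B ℂ) T ≤ (η * (κ / δ)) • X := by
        refine (smul_le_smul_of_nonneg_left e3 hdB.le).trans ?_
        rw [smul_smul, show η / (Fintype.card B : ℝ) * (κ * Fintype.card B) = η * κ by
          field_simp, mul_smul, mul_smul]
        exact smul_le_smul_of_nonneg_left (hδ1 (hslice hB)) h0.le
      rw [e1, add_smul]
      exact add_le_add e2 e4
    have hlogX := trace_mul_log_mono hA.1 hXη hXle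
    rw [trace_mul_log_smul _ hX (by positivity), hA.2] at hlogX
    have hlA := trace_mul_log_add_one_ge hA.1 (show 0 < 1 - η by linarith) hdA
    have hlB := trace_mul_log_add_one_ge hB.1 (show 0 < 1 - η by linarith) hdB
    rw [← hωA, hA.2] at hlA
    rw [← hωB, hB.2] at hlB
    rw [relEntropy, cfc_log_kronecker hA' hB', Matrix.mul_add, Matrix.trace_add,
      trace_mul_kronecker_one, trace_mul_one_kronecker, Complex.add_re] at hmain
    simp only [Complex.one_re, mul_one] at hlogX hlA hlB
    simp only [mutualInfo, entropy]
    linarith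
  have hlim : Tendsto (fun η : ℝ => ((ρ * cfc Real.log T).trace).re
      - ((reduceFst ρ * cfc Real.log X).trace).re - Real.log (1 + η * (κ / δ))
        + 2 * Real.log (1 - η)) (𝓝[>] 0)
      (𝓝 (((ρ * cfc Real.log T).trace).re
      - ((reduceFst ρ * cfc Real.log X).trace).re - Real.log (1 + 0 * (κ / δ))
        + 2 * Real.log (1 - 0))) := by
    refine tendsto_nhdsWithin_of_tendsto_nhds (ContinuousAt.tendsto ?_)
    refine (continuousAt_const.sub (ContinuousAt.log (by fun_prop) (by norm_num))).add
      (continuousAt_const.mul (ContinuousAt.log (by fun_prop) (by norm_num)))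
  rw [zero_mul, add_zero, sub_zero, Real.log_one, sub_zero, mul_zero, add_zero] at hlim
  exact le_of_tendsto hlim (Filter.mem_of_superset (Ioo_mem_nhdsGT one_pos) fun η hη => key η hη)

end Slice

/-! ### Local isometries -/

section Isometry

variable {A B W C : Type*} [Fintype A] [Fintype B] [DecidableEq A] [DecidableEq B]
  [Fintype W] [Fintype C] [DecidableEq W] [DecidableEq C]

lemma reduceFst_conj (V₁ : Matrix W A ℂ) {V₂ : Matrix C B ℂ}
    (h₂ : V₂ᴴ * V₂ = 1) (ρ : Matrix (A × B) (A × B) ℂ) :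
    reduceFst ((V₁ ⊗ₖ V₂) * ρ * (V₁ ⊗ₖ V₂)ᴴ) = V₁ * reduceFst ρ * V₁ᴴ := by
  refine Matrix.ext_iff_trace_mul_right.2 fun M => ?_
  rw [← trace_mul_kronecker_one, Matrix.mul_assoc, Matrix.mul_assoc, Matrix.trace_mul_comm,
    Matrix.mul_assoc, Matrix.mul_assoc, Matrix.conjTranspose_kronecker, ← Matrix.mul_kronecker_mul,
    ← Matrix.mul_kronecker_mul, Matrix.one_mul, h₂, trace_mul_kronecker_one, ← Matrix.mul_assoc,
    Matrix.trace_mul_comm, ← Matrix.mul_assoc, Matrix.trace_mul_comm (V₁ * reduceFst ρ * V₁ᴴ) M]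
  simp only [Matrix.mul_assoc]

lemma reduceSnd_conj {V₁ : Matrix W A ℂ} (h₁ : V₁ᴴ * V₁ = 1) (V₂ : Matrix C B ℂ)
    (ρ : Matrix (A × B) (A × B) ℂ) :
    reduceSnd ((V₁ ⊗ₖ V₂) * ρ * (V₁ ⊗ₖ V₂)ᴴ) = V₂ * reduceSnd ρ * V₂ᴴ := by
  refine Matrix.ext_iff_trace_mul_right.2 fun M => ?_
  rw [← trace_mul_one_kronecker, Matrix.mul_assoc, Matrix.mul_assoc, Matrix.trace_mul_comm,
    Matrix.mul_assoc, Matrix.mul_assoc, Matrix.conjTranspose_kronecker, ← Matrix.mul_kronecker_mul,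
    ← Matrix.mul_kronecker_mul, Matrix.one_mul, h₁, trace_mul_one_kronecker, ← Matrix.mul_assoc,
    Matrix.trace_mul_comm, ← Matrix.mul_assoc, Matrix.trace_mul_comm (V₂ * reduceSnd ρ * V₂ᴴ) M]
  simp only [Matrix.mul_assoc]

lemma kronecker_isometry {V₁ : Matrix W A ℂ} {V₂ : Matrix C B ℂ} (h₁ : V₁ᴴ * V₁ = 1)
    (h₂ : V₂ᴴ * V₂ = 1) : (V₁ ⊗ₖ V₂)ᴴ * (V₁ ⊗ₖ V₂) = 1 := by
  rw [Matrix.conjTranspose_kronecker, ← Matrix.mul_kronecker_mul, h₁, h₂, Matrix.one_kronecker_one]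

lemma IsDensity.conj_isometry {X Y : Type*} [Fintype X] [Fintype Y] [DecidableEq Y]
    {V : Matrix X Y ℂ} (hV : Vᴴ * V = 1) {ρ : Matrix Y Y ℂ} (hρ : IsDensity ρ) :
    IsDensity (V * ρ * Vᴴ) := by
  refine ⟨hρ.1.mul_mul_conjTranspose_same V, ?_⟩
  rw [Matrix.mul_assoc, Matrix.trace_mul_comm, Matrix.mul_assoc, hV, Matrix.mul_one, hρ.2]

lemma mutualInfo_conj {V₁ : Matrix W A ℂ} {V₂ : Matrix C B ℂ} (h₁ : V₁ᴴ * V₁ = 1)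
    (h₂ : V₂ᴴ * V₂ = 1) {ρ : Matrix (A × B) (A × B) ℂ} (hρ : IsDensity ρ) :
    mutualInfo ((V₁ ⊗ₖ V₂) * ρ * (V₁ ⊗ₖ V₂)ᴴ) = mutualInfo ρ := by
  rw [mutualInfo, reduceFst_conj V₁ h₂, reduceSnd_conj h₁, entropy_conj_isometry h₁ hρ.reduceFst.1.1,
    entropy_conj_isometry h₂ hρ.reduceSnd.1.1, entropy_conj_isometry (kronecker_isometry h₁ h₂) hρ.1.1,
    mutualInfo]

end Isometry

/-! ### Operator inequalities -/

section Operator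

variable {W : Type*} [Fintype W] [DecidableEq W]

lemma conj_nonneg {S T : Matrix W W ℂ} (hS : S.IsHermitian) (hT : 0 ≤ T) : 0 ≤ S * T * S := by
  have := (Matrix.nonneg_iff_posSemidef.1 hT).conjTranspose_mul_mul_same S
  rw [hS.eq] at this
  exact Matrix.nonneg_iff_posSemidef.2 this

lemma conj_mono {S T T' : Matrix W W ℂ} (hS : S.IsHermitian) (h : T ≤ T') :
    S * T * S ≤ S * T' * S := by
  have := conj_nonneg hS (sub_nonneg.2 h)
  rw [Matrix.mul_sub, Matrix.sub_mul] at this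
  exact sub_nonneg.1 this

/-- c(c − K) = (c − K)² + (cK − K²), and both summands are nonnegative. -/
lemma le_smul_one_of_mul_self_le {K : Matrix W W ℂ} (hK : K.IsHermitian) {c : ℝ} (hc : 0 < c)
    (h : K * K ≤ c • K) : K ≤ c • (1 : Matrix W W ℂ) := by
  have hh : (c • (1 : Matrix W W ℂ) - K).IsHermitian :=
    ((Matrix.PosDef.one.smul hc).1).sub hK
  have h1 : 0 ≤ (c • (1 : Matrix W W ℂ) - K) * 1 * (c • (1 : Matrix W W ℂ) - K) :=
    conj_nonneg hh zero_le_one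
  have h2 := add_nonneg h1 (sub_nonneg.2 h)
  have h3 : (c • (1 : Matrix W W ℂ) - K) * 1 * (c • (1 : Matrix W W ℂ) - K) + (c • K - K * K)
      = c • (c • (1 : Matrix W W ℂ) - K) := by
    simp only [Matrix.mul_one, Matrix.sub_mul, Matrix.mul_sub, Matrix.smul_mul, Matrix.mul_smul,
      Matrix.one_mul, smul_sub]
    abel
  rw [h3] at h2
  have h4 := smul_nonneg (inv_nonneg.2 hc.le) h2
  rw [smul_smul, inv_mul_cancel₀ hc.ne', one_smul] at h4
  exact sub_nonneg.1 h4

/-- Both inequalities say that √X √Y has squared norm at most c: writing `Y = Sᴴ * S`, each amounts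
to S X Sᴴ ≤ c. -/
lemma mul_mul_le_symm {X Y : Matrix W W ℂ} (hX : 0 ≤ X) (hY : 0 ≤ Y) {c : ℝ} (hc : 0 < c)
    (h : X * Y * X ≤ c • X) : Y * X * Y ≤ c • Y := by
  obtain ⟨S, rfl⟩ := CStarAlgebra.nonneg_iff_eq_star_mul_self.mp hY
  rw [Matrix.star_eq_conjTranspose] at *
  have hK : (S * X * Sᴴ).PosSemidef :=
    (Matrix.nonneg_iff_posSemidef.1 hX).mul_mul_conjTranspose_same S
  have h1 : (S * X * Sᴴ) * (S * X * Sᴴ) ≤ c • (S * X * Sᴴ) := by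
    have h2 := (Matrix.le_iff.1 h).mul_mul_conjTranspose_same S
    rw [Matrix.le_iff]
    convert h2 using 1
    simp only [Matrix.mul_sub, Matrix.sub_mul, Matrix.mul_smul, Matrix.smul_mul, Matrix.mul_assoc]
  have h3 := (Matrix.le_iff.1 (le_smul_one_of_mul_self_le hK.1 hc h1)).conjTranspose_mul_mul_same S
  rw [Matrix.le_iff]
  convert h3 using 1
  simp only [Matrix.mul_sub, Matrix.sub_mul, Matrix.mul_smul, Matrix.smul_mul, Matrix.mul_assoc,
    Matrix.one_mul]

/-- The condition is monotone in the middle factor by conjugation; exchanging the roles of the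
factors makes it monotone in the outer one too. This is why upper bounds on the slices suffice. -/
lemma mul_mul_le_of_le {X Y X' Y' : Matrix W W ℂ} (hX : 0 ≤ X) (hY : 0 ≤ Y) (hXX' : X ≤ X')
    (hYY' : Y ≤ Y') {c : ℝ} (hc : 0 < c) (h : X' * Y' * X' ≤ c • X') : X * Y * X ≤ c • X := by
  have hX' := hX.trans hXX'
  have hY' := hY.trans hYY'
  have h1 := mul_mul_le_symm hX' hY' hc h
  have h2 := (conj_mono (Matrix.nonneg_iff_posSemidef.1 hY').1 hXX').trans h1
  have h3 := mul_mul_le_symm hY' hX hc h2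
  exact (conj_mono (Matrix.nonneg_iff_posSemidef.1 hX).1 hYY').trans h3

/-- Expand s⁻¹(X − s)Y(X − s) ≥ 0, an operator form of the weighted arithmetic-geometric mean
inequality. -/
lemma mul_add_mul_le {X Y : Matrix W W ℂ} (hX : 0 ≤ X) (hY : 0 ≤ Y) {s : ℝ} (hs : 0 < s) :
    X * Y + Y * X ≤ s⁻¹ • (X * Y * X) + s • Y := by
  have hh : (X - s • (1 : Matrix W W ℂ)).IsHermitian :=
    (Matrix.nonneg_iff_posSemidef.1 hX).1.sub ((Matrix.PosDef.one.smul hs).1)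
  have h1 := smul_nonneg (inv_nonneg.2 hs.le) (conj_nonneg hh hY)
  rw [← sub_nonneg]
  convert h1 using 1
  simp only [Matrix.mul_sub, Matrix.sub_mul, Matrix.mul_smul, Matrix.smul_mul, smul_sub, smul_smul,
    Matrix.one_mul, Matrix.mul_one, inv_mul_cancel₀ hs.ne', inv_mul_cancel_left₀ hs.ne', one_smul]
  abel

lemma mul_self_le {X : Matrix W W ℂ} (hX : 0 ≤ X) (hX1 : X ≤ 1) : X * X ≤ X := by
  have hX' := (Matrix.nonneg_iff_posSemidef.1 hX).1
  obtain ⟨S, rfl⟩ := CStarAlgebra.nonneg_iff_eq_star_mul_self.mp hX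
  rw [Matrix.star_eq_conjTranspose] at *
  have hK : (S * Sᴴ).PosSemidef := Matrix.posSemidef_self_mul_conjTranspose S
  have h1 : (S * Sᴴ) * (S * Sᴴ) ≤ (1 : ℝ) • (S * Sᴴ) := by
    have h2 := (Matrix.le_iff.1 hX1).mul_mul_conjTranspose_same S
    rw [Matrix.le_iff]
    convert h2 using 1
    simp only [Matrix.mul_sub, Matrix.sub_mul, Matrix.mul_assoc, one_smul, Matrix.mul_one]
  have h3 := (Matrix.le_iff.1 (le_smul_one_of_mul_self_le hK.1 one_pos h1)).conjTranspose_mul_mul_same S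
  rw [Matrix.le_iff]
  convert h3 using 1
  simp only [Matrix.mul_sub, Matrix.sub_mul, Matrix.mul_assoc, one_smul, Matrix.one_mul]

/-- The bound of Tomamichel, Fehr, Kaniewski and Wehner on the norm of a sum of positive operators
with small overlaps. -/
lemma sum_le_smul_one_of_overlap {Q : Type*} [Fintype Q] (X : Q → Matrix W W ℂ) (hX : ∀ q, 0 ≤ X q)
    (a : Q → Q → ℝ) (ha : ∀ q q', 0 < a q q') (hsymm : ∀ q q', a q q' = a q' q)
    (hov : ∀ q q', X q * X q' * X q ≤ (a q q' ^ 2) • X q) {L : ℝ} (hL : 0 < L)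
    (hsum : ∀ q, ∑ q', a q q' ≤ L) : ∑ q, X q ≤ L • (1 : Matrix W W ℂ) := by
  -- The choice s = a(q, q') balances the two terms of `mul_add_mul_le`. Summing over all pairs and
  -- using the row sums gives S² ≤ L S for the total S.
  have hpair : ∀ q q', X q * X q' + X q' * X q ≤ a q q' • X q + a q q' • X q' := by
    intro q q'
    refine (mul_add_mul_le (hX q) (hX q') (ha q q')).trans (add_le_add ?_ le_rfl)
    have := smul_le_smul_of_nonneg_left (hov q q') (inv_nonneg.2 (ha q q').le)
    rwa [smul_smul, pow_two, ← mul_assoc, inv_mul_cancel₀ (ha q q').ne', one_mul] at this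
  set S := ∑ q, X q with hS
  have hS0 : 0 ≤ S := Finset.sum_nonneg fun q _ => hX q
  have hSS : ∑ q, ∑ q', (X q * X q' + X q' * X q) = (2 : ℝ) • (S * S) := by
    have e1 : ∑ q, ∑ q', X q * X q' = S * S := by rw [hS, Finset.sum_mul_sum]
    have e2 : ∑ q, ∑ q', X q' * X q = S * S := by rw [Finset.sum_comm, e1]
    simp only [Finset.sum_add_distrib]
    rw [e1, e2, two_smul]
  have hbound : ∀ q, (∑ q', a q q') • X q ≤ L • X q := fun q =>
    smul_le_smul_of_nonneg_right (hsum q) (hX q)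
  have hright : ∑ q, ∑ q', (a q q' • X q + a q q' • X q') ≤ (2 : ℝ) • (L • S) := by
    have e1 : ∑ q, ∑ q', a q q' • X q ≤ L • S := by
      rw [hS, Finset.smul_sum]
      refine Finset.sum_le_sum fun q _ => ?_
      rw [← Finset.sum_smul]
      exact hbound q
    have e2 : ∑ q, ∑ q', a q q' • X q' ≤ L • S := by
      rw [Finset.sum_comm]
      refine le_trans (le_of_eq ?_) e1
      exact Finset.sum_congr rfl fun q _ => Finset.sum_congr rfl fun q' _ => by rw [hsymm]
    simp only [Finset.sum_add_distrib]
    rw [two_smul]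
    exact add_le_add e1 e2
  have h2 : (2 : ℝ) • (S * S) ≤ (2 : ℝ) • (L • S) := by
    rw [← hSS]
    exact (Finset.sum_le_sum fun q _ => Finset.sum_le_sum fun q' _ => hpair q q').trans hright
  have h3 := smul_le_smul_of_nonneg_left h2 (show (0 : ℝ) ≤ 2⁻¹ by norm_num)
  rw [smul_smul, smul_smul, inv_mul_cancel₀ two_ne_zero, one_smul, one_smul] at h3
  exact le_smul_one_of_mul_self_le (Matrix.nonneg_iff_posSemidef.1 hS0).1 hL h3

/-- The shift keeps the logarithms finite. Taking it equal to the overlap bound δ costs only a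
factor 4; the condition δ ≤ 1/2 is what absorbs the term 2δ²X. -/
lemma shifted_mul_mul_le {X Y : Matrix W W ℂ} (hX : 0 ≤ X) (hX1 : X ≤ 1) (hY : 0 ≤ Y)
    (hY1 : Y ≤ 1) {δ : ℝ} (hδ : 0 < δ) (hδ2 : δ ≤ 1 / 2) (h : X * Y * X ≤ δ • X) :
    (X + δ • 1) * (Y + δ • 1) * (X + δ • 1) ≤ (4 * δ) • (X + δ • (1 : Matrix W W ℂ)) := by
  have h1 : X * Y + Y * X ≤ X + δ • 1 := by
    refine (mul_add_mul_le hX hY hδ).trans (add_le_add ?_ (smul_le_smul_of_nonneg_left hY1 hδ.le))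
    have := smul_le_smul_of_nonneg_left h (inv_nonneg.2 hδ.le)
    rwa [smul_smul, inv_mul_cancel₀ hδ.ne', one_smul] at this
  have h1' := smul_le_smul_of_nonneg_left h1 hδ.le
  have h2 := smul_le_smul_of_nonneg_left hY1 (show 0 ≤ δ * δ by positivity)
  have h3 := smul_le_smul_of_nonneg_left (mul_self_le hX hX1) hδ.le
  have e : (X + δ • 1) * (Y + δ • 1) * (X + δ • (1 : Matrix W W ℂ))
      = X * Y * X + δ • (X * Y + Y * X) + (δ * δ) • Y + δ • (X * X) + (2 * (δ * δ)) • X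
        + (δ * δ * δ) • 1 := by
    simp only [Matrix.mul_add, Matrix.add_mul, Matrix.mul_smul, Matrix.smul_mul, smul_add, smul_smul,
      Matrix.one_mul, Matrix.mul_one, two_mul, add_smul]
    module
  rw [e]
  have h4 : X * Y * X + δ • (X * Y + Y * X) + (δ * δ) • Y + δ • (X * X) + (2 * (δ * δ)) • X
        + (δ * δ * δ) • 1 ≤ δ • X + δ • (X + δ • 1) + (δ * δ) • 1 + δ • X + (2 * (δ * δ)) • X
        + (δ * δ * δ) • 1 := by gcongr
  refine h4.trans ?_
  have h5 : (0 : Matrix W W ℂ) ≤ (δ - 2 * (δ * δ)) • X :=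
    smul_nonneg (by nlinarith) hX
  have h6 : (0 : Matrix W W ℂ) ≤ (2 * (δ * δ) - δ * δ * δ) • 1 :=
    smul_nonneg (by nlinarith [mul_pos hδ hδ]) zero_le_one
  rw [← sub_nonneg]
  convert add_nonneg h5 h6 using 1
  module

lemma cfc_log_inv {X : Matrix W W ℂ} (hX : X.PosDef) :
    cfc Real.log X⁻¹ = -cfc Real.log X := by
  have h0 := inv_add_smul_eq_cfc hX le_rfl
  rw [zero_smul, add_zero] at h0
  rw [h0, ← cfc_comp' Real.log (fun x : ℝ => 1 / (x + 0)) X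
    (Set.Finite.continuousOn (X.finite_real_spectrum.image _) _) (continuousOn_spectrum _ _)
    hX.1.isSelfAdjoint, ← cfc_neg]
  refine cfc_congr fun x _ => ?_
  simp [Real.log_inv]

/-- A logarithmic form of the entropic uncertainty relation. -/
lemma trace_mul_log_add_le {X Y : Matrix W W ℂ} (hX : 0 ≤ X) (hX1 : X ≤ 1) (hY : 0 ≤ Y)
    (hY1 : Y ≤ 1) {δ : ℝ} (hδ : 0 < δ) (hδ2 : δ ≤ 1 / 2) (h : X * Y * X ≤ δ • X)
    {ω : Matrix W W ℂ} (hω : IsDensity ω) :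
    ((ω * cfc Real.log (X + δ • (1 : Matrix W W ℂ))).trace).re
      + ((ω * cfc Real.log (Y + δ • (1 : Matrix W W ℂ))).trace).re ≤ Real.log (4 * δ) := by
  have hXd : (X + δ • (1 : Matrix W W ℂ)).PosDef :=
    posDef_of_smul_one_le hδ (le_add_of_nonneg_left hX)
  have hYd : (Y + δ • (1 : Matrix W W ℂ)).PosDef :=
    posDef_of_smul_one_le hδ (le_add_of_nonneg_left hY)
  have hdet := (Matrix.isUnit_iff_isUnit_det _).1 hXd.isUnit
  have h1 := conj_mono hXd.inv.1 (shifted_mul_mul_le hX hX1 hY hY1 hδ hδ2 h)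
  -- Cancelling X + δ on both sides leaves an inequality between Y + δ and the inverse of X + δ, to
  -- which operator monotonicity of the logarithm applies.
  have h2 : Y + δ • 1 ≤ (4 * δ) • (X + δ • (1 : Matrix W W ℂ))⁻¹ := by
    convert h1 using 1
    · rw [Matrix.mul_assoc, Matrix.mul_assoc, Matrix.mul_nonsing_inv _ hdet, Matrix.mul_one,
        ← Matrix.mul_assoc, Matrix.nonsing_inv_mul _ hdet, Matrix.one_mul]
    · rw [Matrix.mul_smul, Matrix.nonsing_inv_mul _ hdet, Matrix.smul_mul, Matrix.one_mul]
  have h3 := trace_mul_log_mono hω.1 hYd h2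
  rw [trace_mul_log_smul ω hXd.inv (by positivity), hω.2, cfc_log_inv hXd, Matrix.mul_neg,
    Matrix.trace_neg, Complex.neg_re, Complex.one_re, mul_one] at h3
  linarith

/-- The graph of the logarithm lies below its tangent at `m`; average this over the eigenvalues. -/
lemma trace_mul_log_le {X : Matrix W W ℂ} (hX : X.PosDef) {ω : Matrix W W ℂ} (hω : IsDensity ω)
    {m : ℝ} (hm : 0 < m) :
    ((ω * cfc Real.log X).trace).re ≤ Real.log m + ((ω * X).trace).re / m - 1 := by
  have h1 := trace_mul_cfc ω hX.1 id
  rw [cfc_id ℝ X hX.1.isSelfAdjoint] at h1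
  have h2 := sum_eigenWeight ω hX.1
  rw [hω.2, Complex.one_re] at h2
  rw [trace_mul_cfc ω hX.1, h1]
  have h3 : Real.log m + (∑ j, eigenWeight ω hX.1 j * id (hX.1.eigenvalues j)) / m - 1
      = ∑ j, eigenWeight ω hX.1 j * (Real.log m + hX.1.eigenvalues j / m - 1) := by
    simp only [mul_sub, mul_add, Finset.sum_sub_distrib, Finset.sum_add_distrib, ← Finset.sum_mul,
      h2, one_mul, mul_one, id, Finset.sum_div, mul_div_assoc]
  rw [h3]
  refine Finset.sum_le_sum fun j _ => mul_le_mul_of_nonneg_left ?_ (eigenWeight_nonneg hω.1 _ j)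
  have hp := hX.eigenvalues_pos j
  have := Real.log_le_sub_one_of_pos (div_pos hp hm)
  rw [Real.log_div hp.ne' hm.ne'] at this
  linarith

lemma eigenvalues_le_one {E : Matrix W W ℂ} (hE : E.IsHermitian) (hE1 : E ≤ 1) (j : W) :
    hE.eigenvalues j ≤ 1 := by
  have h1 := eigenWeight_nonneg (Matrix.le_iff.1 hE1) hE j
  have h2 := eigenWeight_self hE j
  have hUU : star (hE.eigenvectorUnitary : Matrix W W ℂ) * hE.eigenvectorUnitary = 1 :=
    Unitary.coe_star_mul_self hE.eigenvectorUnitary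
  rw [eigenWeight] at h1 h2
  rw [Matrix.mul_sub, Matrix.sub_mul, Matrix.mul_one, hUU, Matrix.sub_apply, Complex.sub_re, h2,
    Matrix.one_apply_eq, Complex.one_re] at h1
  linarith

/-- For 0 ≤ e ≤ 1, concavity gives (1 − e) log δ ≤ log((1 − e)δ + e) ≤ log(e + δ); average this over
the eigenvalues of `E`. A test passed with high probability thus has an expected logarithm that is
not too negative. -/
lemma mul_log_le_trace_mul_log_add {E : Matrix W W ℂ} (hE : 0 ≤ E) (hE1 : E ≤ 1)
    {ρ : Matrix W W ℂ} (hρ : IsDensity ρ) {δ : ℝ} (hδ : 0 < δ) :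
    (1 - ((ρ * E).trace).re) * Real.log δ
      ≤ ((ρ * cfc Real.log (E + δ • (1 : Matrix W W ℂ))).trace).re := by
  have hEp := Matrix.nonneg_iff_posSemidef.1 hE
  have hsa := hEp.1.isSelfAdjoint
  have h1 := trace_mul_cfc ρ hEp.1 id
  rw [cfc_id ℝ E hsa] at h1
  have h2 := sum_eigenWeight ρ hEp.1
  rw [hρ.2, Complex.one_re] at h2
  have h3 : E + δ • (1 : Matrix W W ℂ) = cfc (fun x : ℝ => x + δ) E := by
    rw [cfc_add_const δ (fun x => x) E (continuousOn_spectrum _ _) hsa, cfc_id' ℝ E,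
      Algebra.algebraMap_eq_smul_one]
  rw [h3, ← cfc_comp' Real.log (fun x => x + δ) E
    (Set.Finite.continuousOn (E.finite_real_spectrum.image _) _) (continuousOn_spectrum _ _) hsa,
    trace_mul_cfc ρ hEp.1, h1, ← h2, ← Finset.sum_sub_distrib, Finset.sum_mul]
  refine Finset.sum_le_sum fun j _ => ?_
  have h0 := hEp.eigenvalues_nonneg j
  have h4 := eigenvalues_le_one hEp.1 hE1 j
  have h5 := eigenWeight_nonneg hρ.1 hEp.1 j
  set e := hEp.1.eigenvalues j
  have h6 : (1 - e) * Real.log δ ≤ Real.log (e + δ) := by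
    have h7 := strictConcaveOn_log_Ioi.concaveOn.2 (Set.mem_Ioi.2 hδ) (Set.mem_Ioi.2 one_pos)
      (sub_nonneg.2 h4) h0 (by ring)
    simp only [smul_eq_mul, Real.log_one, mul_zero, add_zero, mul_one] at h7
    refine h7.trans (Real.log_le_log ?_ (by nlinarith))
    rcases h0.eq_or_lt with h | h
    · rw [← h]; linarith
    · have := mul_nonneg (sub_nonneg.2 h4) hδ.le
      linarith
  have h8 := mul_le_mul_of_nonneg_left h6 h5
  simp only [id]
  linarith

end Operator

/-! ### The input states -/

section Kets

lemma inputKet_zero (b : Fin 2) : inputKet 0 b = Pi.single b 1 := by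
  ext x
  simp [inputKet, Matrix.col, Matrix.one_apply, Pi.single_apply, eq_comm]

lemma inputKet_one (b x : Fin 2) : inputKet 1 b x = hadamard x b := by
  simp [inputKet]

lemma sqrt_two_inv_sq : ((√2 : ℝ)⁻¹) * (√2)⁻¹ = 1 / 2 := by
  rw [← mul_inv, Real.mul_self_sqrt (by norm_num)]; norm_num

lemma sqrt_two_inv_sq_complex : (((√2 : ℝ) : ℂ)⁻¹) * ((√2 : ℝ) : ℂ)⁻¹ = 1 / 2 := by
  have := congrArg (fun r : ℝ => (r : ℂ)) sqrt_two_inv_sq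
  push_cast at this
  exact this

lemma sum_star_inputKet_mul (q x y : Fin 2) :
    ∑ b, star (inputKet q b x) * inputKet q b y = if x = y then 1 else 0 := by
  have h := sqrt_two_inv_sq_complex
  fin_cases q
  · fin_cases x <;> fin_cases y <;> simp [inputKet_zero, Fin.sum_univ_two]
  · fin_cases x <;> fin_cases y <;>
      simp [inputKet_one, Fin.sum_univ_two, hadamard, h] <;> norm_num

/-- The computational and Hadamard bases are mutually unbiased: every squared overlap between them
is 1/2. -/
lemma normSq_inputKet_dotProduct_le (q q' b b' : Fin 2) :
    Complex.normSq (∑ x, inputKet q b x * star (inputKet q' b' x))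
      ≤ (if q = q' then 1 else (√2)⁻¹) ^ 2 := by
  have h := sqrt_two_inv_sq_complex
  have h' := sqrt_two_inv_sq
  fin_cases q <;> fin_cases q' <;> fin_cases b <;> fin_cases b' <;>
    simp [inputKet_one, inputKet_zero, Fin.sum_univ_two, hadamard, h, h', pow_two] <;> norm_num

/-- The largest overlap of the bases labelled by `q` and `q'`. -/
def basisOverlap {n : ℕ} (q q' : Bits n) : ℝ := ∏ i, if q i = q' i then 1 else (√2)⁻¹

lemma basisOverlap_pos {n : ℕ} (q q' : Bits n) : 0 < basisOverlap q q' :=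
  Finset.prod_pos fun i _ => by split_ifs <;> positivity

lemma basisOverlap_comm {n : ℕ} (q q' : Bits n) : basisOverlap q q' = basisOverlap q' q :=
  Finset.prod_congr rfl fun i _ => by simp only [eq_comm]

lemma sum_basisOverlap {n : ℕ} (q : Bits n) :
    ∑ q', basisOverlap q q' = (1 + (√2)⁻¹) ^ n := by
  have h := (Finset.prod_univ_sum (fun _ : Fin n => (Finset.univ : Finset (Fin 2)))
    (fun i c => if q i = c then (1 : ℝ) else (√2)⁻¹)).symm
  rw [Fintype.piFinset_univ] at h
  simp only [basisOverlap]
  rw [h]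
  have h2 : ∀ c : Fin 2, ∑ j : Fin 2, (if c = j then (1 : ℝ) else (√2)⁻¹) = 1 + (√2)⁻¹ := by
    intro c
    fin_cases c <;> simp [Fin.sum_univ_two, add_comm]
  simp [h2]

/-- Flipping every bit of `q` changes the basis of every qubit, so each contributes a factor 1/2. -/
lemma basisOverlap_complement {n : ℕ} (q : Bits n) :
    basisOverlap q (fun i => 1 - q i) ^ 2 = (1 / 2 : ℝ) ^ n := by
  have h : ∀ c : Fin 2, c ≠ 1 - c := by decide
  simp only [basisOverlap, h, if_false, Finset.prod_const, Finset.card_univ, Fintype.card_fin]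
  rw [← pow_mul, mul_comm, pow_mul, pow_two, sqrt_two_inv_sq]

/-- The transpose of the projector on an input state. -/
def inputProj {n : ℕ} (q b : Bits n) : Matrix (Bits n) (Bits n) ℂ := (inputState q b)ᵀ

lemma inputProj_eq {n : ℕ} (q b : Bits n) :
    inputProj q b = Matrix.vecMulVec (star (inputKets q b)) (inputKets q b) := by
  rw [inputProj, inputState, Matrix.transpose_vecMulVec]

lemma inputProj_nonneg {n : ℕ} (q b : Bits n) : 0 ≤ inputProj q b := by
  rw [inputProj_eq, Matrix.nonneg_iff_posSemidef]
  exact Matrix.posSemidef_vecMulVec_star_self _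

lemma sum_inputProj {n : ℕ} (q : Bits n) : ∑ b, inputProj q b = 1 := by
  ext x y
  simp only [inputProj_eq, Matrix.sum_apply, Matrix.vecMulVec_apply, Pi.star_apply, inputKets]
  have h := (Finset.prod_univ_sum (fun _ : Fin n => (Finset.univ : Finset (Fin 2)))
    (fun i c => star (inputKet (q i) c (x i)) * inputKet (q i) c (y i))).symm
  rw [Fintype.piFinset_univ] at h
  simp only [star_prod, ← Finset.prod_mul_distrib]
  rw [h]
  simp only [sum_star_inputKet_mul, Matrix.one_apply, funext_iff]
  by_cases hxy : ∀ i, x i = y i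
  · simp [hxy]
  · rw [if_neg hxy]
    push Not at hxy
    obtain ⟨i, hi⟩ := hxy
    exact Finset.prod_eq_zero (Finset.mem_univ i) (if_neg hi)

lemma normSq_inputKets_dotProduct_le {n : ℕ} (q q' b b' : Bits n) :
    Complex.normSq (inputKets q b ⬝ᵥ star (inputKets q' b')) ≤ basisOverlap q q' ^ 2 := by
  have h := (Finset.prod_univ_sum (fun _ : Fin n => (Finset.univ : Finset (Fin 2)))
    (fun i c => inputKet (q i) (b i) c * star (inputKet (q' i) (b' i) c))).symm
  rw [Fintype.piFinset_univ] at h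
  simp only [dotProduct, inputKets, Pi.star_apply, star_prod, ← Finset.prod_mul_distrib]
  rw [h, map_prod, basisOverlap, ← Finset.prod_pow]
  exact Finset.prod_le_prod (fun i _ => Complex.normSq_nonneg _)
    fun i _ => normSq_inputKet_dotProduct_le _ _ _ _

lemma inputProj_mul_mul {n : ℕ} (q q' b b' : Bits n) :
    inputProj q b * inputProj q' b' * inputProj q b
      = (Complex.normSq (inputKets q b ⬝ᵥ star (inputKets q' b'))) • inputProj q b := by
  simp only [inputProj_eq, Matrix.vecMulVec_mul_vecMulVec, Matrix.vecMulVec_smul,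
    Matrix.smul_mul, smul_smul]
  have : inputKets q' b' ⬝ᵥ star (inputKets q b)
      = star (inputKets q b ⬝ᵥ star (inputKets q' b')) := by
    simp [dotProduct, mul_comm]
  rw [this, Complex.star_def, Complex.mul_conj]
  rfl

end Kets

/-! ### Tensor products, submatrices and the positive semidefinite order -/

section KroneckerOrder

variable {X Y : Type*} [Fintype X] [Fintype Y] [DecidableEq X] [DecidableEq Y]

lemma kronecker_nonneg {S : Matrix X X ℂ} {T : Matrix Y Y ℂ} (hS : 0 ≤ S) (hT : 0 ≤ T) :
    0 ≤ S ⊗ₖ T :=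
  Matrix.nonneg_iff_posSemidef.2
    ((Matrix.nonneg_iff_posSemidef.1 hS).kronecker (Matrix.nonneg_iff_posSemidef.1 hT))

lemma kronecker_mono_right {S : Matrix X X ℂ} {T T' : Matrix Y Y ℂ} (hS : 0 ≤ S) (h : T ≤ T') :
    S ⊗ₖ T ≤ S ⊗ₖ T' := by
  have := kronecker_nonneg hS (sub_nonneg.2 h)
  rw [← sub_nonneg]
  convert this using 1
  ext; simp [mul_sub]

lemma kronecker_mono_left {S S' : Matrix X X ℂ} {T : Matrix Y Y ℂ} (hT : 0 ≤ T) (h : S ≤ S') :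
    S ⊗ₖ T ≤ S' ⊗ₖ T := by
  have := kronecker_nonneg (sub_nonneg.2 h) hT
  rw [← sub_nonneg]
  convert this using 1
  ext; simp [sub_mul]

lemma submatrix_mono {S T : Matrix X X ℂ} (h : S ≤ T) (f : Y → X) :
    S.submatrix f f ≤ T.submatrix f f := by
  have := (Matrix.le_iff.1 h).submatrix f
  rwa [Matrix.submatrix_sub] at this

lemma sum_kronecker {ι : Type*} (s : Finset ι) (S : ι → Matrix X X ℂ) (T : Matrix Y Y ℂ) :
    (∑ i ∈ s, S i) ⊗ₖ T = ∑ i ∈ s, S i ⊗ₖ T := by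
  ext; simp [Matrix.sum_apply, Finset.sum_mul]

lemma kronecker_sum {ι : Type*} (s : Finset ι) (S : Matrix X X ℂ) (T : ι → Matrix Y Y ℂ) :
    S ⊗ₖ (∑ i ∈ s, T i) = ∑ i ∈ s, S ⊗ₖ T i := by
  ext; simp [Matrix.sum_apply, Finset.mul_sum]

end KroneckerOrder

/-- The overlap of the joint measurements `P ⊗ f` and `P' ⊗ g`, where `f` and `g` act on different
systems. -/
lemma overlap_mul_mul_le {R M₁ M₂ β β' : Type*} [Fintype R] [Fintype M₁] [Fintype M₂] [Fintype β]
    [Fintype β'] [DecidableEq R] [DecidableEq M₁] [DecidableEq M₂] [DecidableEq β]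
    [DecidableEq β'] {P : β → Matrix R R ℂ} {P' : β' → Matrix R R ℂ} {f : β → Matrix M₁ M₁ ℂ}
    {g : β' → Matrix M₂ M₂ ℂ} (hP : ∀ b, 0 ≤ P b) (hP' : ∀ b, 0 ≤ P' b) (hf : ∀ b, 0 ≤ f b)
    (hg : ∀ b, 0 ≤ g b) (hf1 : ∑ b, f b = 1) (hg1 : ∑ b, g b = 1) (c : β → β' → ℝ) {C : ℝ}
    (hc : ∀ b b', c b b' ≤ C) (hPP : ∀ b b', P b * P' b' * P b = c b b' • P b) :
    (∑ b, P b ⊗ₖ (f b ⊗ₖ (1 : Matrix M₂ M₂ ℂ))) * (∑ b, P' b ⊗ₖ ((1 : Matrix M₁ M₁ ℂ) ⊗ₖ g b))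
      * (∑ b, P b ⊗ₖ (f b ⊗ₖ (1 : Matrix M₂ M₂ ℂ)))
      ≤ C • ∑ b, P b ⊗ₖ (f b ⊗ₖ (1 : Matrix M₂ M₂ ℂ)) := by
  set Y₁ := ∑ b, P b ⊗ₖ (f b ⊗ₖ (1 : Matrix M₂ M₂ ℂ)) with hY₁
  set Y₂ := ∑ b, P' b ⊗ₖ ((1 : Matrix M₁ M₁ ℂ) ⊗ₖ g b) with hY₂
  set p : β → Matrix (R × M₁ × M₂) (R × M₁ × M₂) ℂ := fun b => P b ⊗ₖ 1 with hp
  set φ : β → Matrix (R × M₁ × M₂) (R × M₁ × M₂) ℂ :=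
    fun b => (1 : Matrix R R ℂ) ⊗ₖ (f b ⊗ₖ (1 : Matrix M₂ M₂ ℂ)) with hφ
  have hY₁0 : 0 ≤ Y₁ := Finset.sum_nonneg fun b _ =>
    kronecker_nonneg (hP b) (kronecker_nonneg (hf b) zero_le_one)
  have hp0 : ∀ b, 0 ≤ p b := fun b => kronecker_nonneg (hP b) zero_le_one
  have hφ1 : ∑ b, φ b = 1 := by
    simp only [hφ]
    rw [← kronecker_sum, ← sum_kronecker, hf1, Matrix.one_kronecker_one, Matrix.one_kronecker_one]
  have hpφ : ∀ b, p b * φ b = P b ⊗ₖ (f b ⊗ₖ (1 : Matrix M₂ M₂ ℂ)) := fun b => by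
    simp only [hp, hφ]
    rw [← Matrix.mul_kronecker_mul, Matrix.mul_one, Matrix.one_mul]
  have hφp : ∀ b, φ b * p b = P b ⊗ₖ (f b ⊗ₖ (1 : Matrix M₂ M₂ ℂ)) := fun b => by
    simp only [hp, hφ]
    rw [← Matrix.mul_kronecker_mul, Matrix.mul_one, Matrix.one_mul]
  have hYφ : ∀ b, Y₂ * φ b = ∑ b', P' b' ⊗ₖ (f b ⊗ₖ g b') := fun b => by
    rw [hY₂, Finset.sum_mul]
    refine Finset.sum_congr rfl fun b' _ => ?_
    simp only [hφ]
    rw [← Matrix.mul_kronecker_mul, ← Matrix.mul_kronecker_mul, Matrix.mul_one, Matrix.one_mul,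
      Matrix.mul_one]
  have hφY : ∀ b, φ b * Y₂ = Y₂ * φ b := fun b => by
    rw [hYφ, hY₂, Finset.mul_sum]
    refine Finset.sum_congr rfl fun b' _ => ?_
    simp only [hφ]
    rw [← Matrix.mul_kronecker_mul, ← Matrix.mul_kronecker_mul, Matrix.mul_one, Matrix.one_mul,
      Matrix.one_mul]
  -- Between two copies of `P b` each `P' b'` collapses to a multiple of `P b`; bounding that
  -- multiple by C, the effects `g b'` can be summed to 1.
  have hpYφp : ∀ b, p b * (Y₂ * φ b) * p b ≤ C • P b ⊗ₖ (f b ⊗ₖ (1 : Matrix M₂ M₂ ℂ)) := fun b => by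
    have e : p b * (Y₂ * φ b) * p b = ∑ b', c b b' • (P b ⊗ₖ (f b ⊗ₖ g b')) := by
      rw [hYφ, Finset.mul_sum, Finset.sum_mul]
      refine Finset.sum_congr rfl fun b' _ => ?_
      simp only [hp]
      rw [← Matrix.mul_kronecker_mul, ← Matrix.mul_kronecker_mul, Matrix.mul_one, Matrix.one_mul,
        hPP, Matrix.smul_kronecker]
    have e2 : C • P b ⊗ₖ (f b ⊗ₖ (1 : Matrix M₂ M₂ ℂ)) = ∑ b', C • (P b ⊗ₖ (f b ⊗ₖ g b')) := by
      rw [← Finset.smul_sum, ← kronecker_sum, ← kronecker_sum, hg1]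
    rw [e, e2]
    exact Finset.sum_le_sum fun b' _ => smul_le_smul_of_nonneg_right (hc b b')
      (kronecker_nonneg (hP b) (kronecker_nonneg (hf b) (hg b')))
  -- A variance inequality: the `φ b` sum to 1 and commute with Y₂, and the products `p b * φ b` sum
  -- to Y₁. All cross terms therefore equal Y₁Y₂Y₁. No projectivity of the effects is needed.
  have hpos : 0 ≤ ∑ b, (Y₁ - p b) * (Y₂ * φ b) * (Y₁ - p b) := by
    refine Finset.sum_nonneg fun b _ => conj_nonneg ?_ ?_
    · exact (Matrix.nonneg_iff_posSemidef.1 hY₁0).1.sub (Matrix.nonneg_iff_posSemidef.1 (hp0 b)).1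
    · rw [hYφ]
      exact Finset.sum_nonneg fun b' _ => kronecker_nonneg (hP' b') (kronecker_nonneg (hf b) (hg b'))
  have hexp : ∑ b, (Y₁ - p b) * (Y₂ * φ b) * (Y₁ - p b)
      = ∑ b, p b * (Y₂ * φ b) * p b - Y₁ * Y₂ * Y₁ := by
    have t1 : ∑ b, Y₁ * (Y₂ * φ b) * Y₁ = Y₁ * Y₂ * Y₁ := by
      rw [← Finset.sum_mul, ← Finset.mul_sum, ← Finset.mul_sum, hφ1, Matrix.mul_one]
    have t2 : ∑ b, Y₁ * (Y₂ * φ b) * p b = Y₁ * Y₂ * Y₁ := by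
      have : ∀ b, Y₁ * (Y₂ * φ b) * p b = Y₁ * Y₂ * (φ b * p b) := fun b => by
        simp only [Matrix.mul_assoc]
      simp only [this, hφp]
      rw [← Finset.mul_sum]
    have t3 : ∑ b, p b * (Y₂ * φ b) * Y₁ = Y₁ * Y₂ * Y₁ := by
      have : ∀ b, p b * (Y₂ * φ b) * Y₁ = (p b * φ b) * (Y₂ * Y₁) := fun b => by
        rw [← hφY]
        simp only [Matrix.mul_assoc]
      simp only [this, hpφ]
      rw [← Finset.sum_mul, Matrix.mul_assoc]
    simp only [Matrix.sub_mul, Matrix.mul_sub, Finset.sum_sub_distrib, t1, t2, t3]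
    abel
  rw [hexp, sub_nonneg] at hpos
  refine hpos.trans ?_
  rw [hY₁, Finset.smul_sum]
  exact Finset.sum_le_sum fun b _ => hpYφp b

lemma POVM.effect_le_one {X O : Type*} [Fintype X] [DecidableEq X] [Fintype O] (E : POVM X O)
    (o : O) : E.effect o ≤ 1 := by
  rw [← E.sum_effect]
  exact Finset.single_le_sum (f := E.effect)
    (fun i _ => Matrix.nonneg_iff_posSemidef.2 (E.posSemidef i)) (Finset.mem_univ o)

lemma POVM.effect_nonneg {X O : Type*} [Fintype X] [DecidableEq X] [Fintype O] (E : POVM X O)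
    (o : O) : 0 ≤ E.effect o := Matrix.nonneg_iff_posSemidef.2 (E.posSemidef o)

/-! ### The winning event and its slices -/

section Test

variable {R M₁ M₂ N₁ N₂ β : Type*} [Fintype R] [Fintype M₁] [Fintype M₂] [Fintype N₁] [Fintype N₂]
  [Fintype β] [DecidableEq R] [DecidableEq M₁] [DecidableEq M₂] [DecidableEq N₁] [DecidableEq N₂]
  [DecidableEq β]

/-- The product of an operator on `M₁ N₁` and one on `M₂ N₂`, as an operator on
`(M₁ M₂) (N₁ N₂)`. -/
def regroup (S₁ : Matrix (M₁ × N₁) (M₁ × N₁) ℂ) (S₂ : Matrix (M₂ × N₂) (M₂ × N₂) ℂ) :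
    Matrix ((M₁ × M₂) × (N₁ × N₂)) ((M₁ × M₂) × (N₁ × N₂)) ℂ :=
  (S₁ ⊗ₖ S₂).submatrix (Equiv.prodProdProdComm M₁ M₂ N₁ N₂) (Equiv.prodProdProdComm M₁ M₂ N₁ N₂)

lemma regroup_one_one : regroup (1 : Matrix (M₁ × N₁) (M₁ × N₁) ℂ)
    (1 : Matrix (M₂ × N₂) (M₂ × N₂) ℂ) = 1 := by
  rw [regroup, Matrix.one_kronecker_one, Matrix.submatrix_one_equiv]

lemma regroup_nonneg {S₁ : Matrix (M₁ × N₁) (M₁ × N₁) ℂ} {S₂ : Matrix (M₂ × N₂) (M₂ × N₂) ℂ}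
    (h₁ : 0 ≤ S₁) (h₂ : 0 ≤ S₂) : 0 ≤ regroup S₁ S₂ := by
  have := submatrix_mono (kronecker_nonneg h₁ h₂) (Equiv.prodProdProdComm M₁ M₂ N₁ N₂)
  rwa [Matrix.submatrix_zero] at this

lemma regroup_mono_left {S₁ S₁' : Matrix (M₁ × N₁) (M₁ × N₁) ℂ}
    {S₂ : Matrix (M₂ × N₂) (M₂ × N₂) ℂ} (h₁ : S₁ ≤ S₁') (h₂ : 0 ≤ S₂) :
    regroup S₁ S₂ ≤ regroup S₁' S₂ := submatrix_mono (kronecker_mono_left h₂ h₁) _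

lemma regroup_mono_right {S₁ : Matrix (M₁ × N₁) (M₁ × N₁) ℂ}
    {S₂ S₂' : Matrix (M₂ × N₂) (M₂ × N₂) ℂ} (h₁ : 0 ≤ S₁) (h₂ : S₂ ≤ S₂') :
    regroup S₁ S₂ ≤ regroup S₁ S₂' := submatrix_mono (kronecker_mono_right h₁ h₂) _

lemma sliceMap_regroup_one (ω : Matrix (N₁ × N₂) (N₁ × N₂) ℂ) (S : Matrix (M₁ × N₁) (M₁ × N₁) ℂ) :
    sliceMap ω (regroup S (1 : Matrix (M₂ × N₂) (M₂ × N₂) ℂ))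
      = sliceMap (reduceFst ω) S ⊗ₖ (1 : Matrix M₂ M₂ ℂ) := by
  ext ⟨m₁, m₂⟩ ⟨m₁', m₂'⟩
  simp only [sliceMap, regroup, reduceFst, Matrix.of_apply, Matrix.submatrix_apply,
    Equiv.prodProdProdComm_apply, Matrix.kronecker_apply, Fintype.sum_prod_type, Matrix.one_apply,
    Prod.mk.injEq]
  by_cases h : m₂ = m₂'
  · simp only [h, true_and, if_true, mul_one, mul_ite, mul_zero, Finset.sum_ite_eq,
      Finset.mem_univ, Finset.sum_mul]
    refine Finset.sum_congr rfl fun n₁ _ => ?_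
    exact Finset.sum_comm
  · simp [h]

lemma sliceMap_one_regroup (ω : Matrix (N₁ × N₂) (N₁ × N₂) ℂ) (S : Matrix (M₂ × N₂) (M₂ × N₂) ℂ) :
    sliceMap ω (regroup (1 : Matrix (M₁ × N₁) (M₁ × N₁) ℂ) S)
      = (1 : Matrix M₁ M₁ ℂ) ⊗ₖ sliceMap (reduceSnd ω) S := by
  ext ⟨m₁, m₂⟩ ⟨m₁', m₂'⟩
  simp only [sliceMap, regroup, reduceSnd, Matrix.of_apply, Matrix.submatrix_apply,
    Equiv.prodProdProdComm_apply, Matrix.kronecker_apply, Fintype.sum_prod_type, Matrix.one_apply,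
    Prod.mk.injEq]
  by_cases h : m₁ = m₁'
  · simp only [h, true_and, if_true, one_mul, ite_mul, mul_ite, mul_zero, zero_mul, Finset.sum_mul]
    rw [Finset.sum_comm]
    refine Finset.sum_congr rfl fun n₂ _ => ?_
    conv_rhs => rw [Finset.sum_comm]
    refine Finset.sum_congr rfl fun n₁ _ => ?_
    rw [Finset.sum_comm]
    simp
  · simp [h]

lemma sliceMap_submatrix_assoc {M C : Type*} [Fintype M] [Fintype C] [DecidableEq M] [DecidableEq C]
    (ω : Matrix C C ℂ) (S : Matrix R R ℂ) (T : Matrix (M × C) (M × C) ℂ) :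
    sliceMap ω ((S ⊗ₖ T).submatrix (Equiv.prodAssoc R M C) (Equiv.prodAssoc R M C))
      = S ⊗ₖ sliceMap ω T := by
  ext ⟨r, m⟩ ⟨r', m'⟩
  simp only [sliceMap, Matrix.of_apply, Matrix.submatrix_apply, Equiv.prodAssoc_apply,
    Matrix.kronecker_apply, Finset.mul_sum]
  refine Finset.sum_congr rfl fun n _ => Finset.sum_congr rfl fun n' _ => ?_
  ring

/-- The effect of the event that both measurements have the outcome found on the reference
system. -/
def winOp (P : β → Matrix R R ℂ) (E₁ : POVM (M₁ × N₁) β) (E₂ : POVM (M₂ × N₂) β) :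
    Matrix ((R × (M₁ × M₂)) × (N₁ × N₂)) ((R × (M₁ × M₂)) × (N₁ × N₂)) ℂ :=
  ∑ b, (P b ⊗ₖ regroup (E₁.effect b) (E₂.effect b)).submatrix
    (Equiv.prodAssoc R (M₁ × M₂) (N₁ × N₂)) (Equiv.prodAssoc R (M₁ × M₂) (N₁ × N₂))

variable {P : β → Matrix R R ℂ} (E₁ : POVM (M₁ × N₁) β) (E₂ : POVM (M₂ × N₂) β)

lemma winOp_nonneg (hP : ∀ b, 0 ≤ P b) : 0 ≤ winOp P E₁ E₂ := by
  refine Finset.sum_nonneg fun b _ => ?_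
  have := submatrix_mono (kronecker_nonneg (hP b) (regroup_nonneg (E₁.effect_nonneg b)
    (E₂.effect_nonneg b))) (Equiv.prodAssoc R (M₁ × M₂) (N₁ × N₂))
  rwa [Matrix.submatrix_zero] at this

lemma winOp_le_one (hP : ∀ b, 0 ≤ P b) (hP1 : ∑ b, P b = 1) : winOp P E₁ E₂ ≤ 1 := by
  have h1 : (1 : Matrix ((R × (M₁ × M₂)) × (N₁ × N₂)) ((R × (M₁ × M₂)) × (N₁ × N₂)) ℂ)
      = ∑ b, (P b ⊗ₖ (1 : Matrix ((M₁ × M₂) × (N₁ × N₂)) ((M₁ × M₂) × (N₁ × N₂)) ℂ)).submatrix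
        (Equiv.prodAssoc R (M₁ × M₂) (N₁ × N₂)) (Equiv.prodAssoc R (M₁ × M₂) (N₁ × N₂)) := by
    have h2 : (∑ b, P b ⊗ₖ
        (1 : Matrix ((M₁ × M₂) × (N₁ × N₂)) ((M₁ × M₂) × (N₁ × N₂)) ℂ)) = 1 := by
      rw [← sum_kronecker, hP1, Matrix.one_kronecker_one]
    rw [← Matrix.submatrix_one_equiv (Equiv.prodAssoc R (M₁ × M₂) (N₁ × N₂)), ← h2]
    ext
    simp [Matrix.sum_apply]
  rw [h1]
  refine Finset.sum_le_sum fun b _ => submatrix_mono (kronecker_mono_right (hP b) ?_) _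
  rw [← regroup_one_one]
  exact (regroup_mono_left (E₁.effect_le_one b) (E₂.effect_nonneg b)).trans
    (regroup_mono_right zero_le_one (E₂.effect_le_one b))

lemma sliceMap_winOp (ω : Matrix (N₁ × N₂) (N₁ × N₂) ℂ) : sliceMap ω (winOp P E₁ E₂)
    = ∑ b, P b ⊗ₖ sliceMap ω (regroup (E₁.effect b) (E₂.effect b)) := by
  rw [winOp, sliceMap_sum]
  exact Finset.sum_congr rfl fun b _ => sliceMap_submatrix_assoc _ _ _

/-- Forgetting the measurement at the second output point leaves an operator that acts trivially on
`M₂`; `sliceMap_winOp_le_snd` is the counterpart for `M₁`. Using one bound for each of two bases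
makes the two measurements act on different systems, which is where monogamy enters. -/
lemma sliceMap_winOp_le_fst {ω : Matrix (N₁ × N₂) (N₁ × N₂) ℂ} (hω : IsDensity ω)
    (hP : ∀ b, 0 ≤ P b) : sliceMap ω (winOp P E₁ E₂)
      ≤ ∑ b, P b ⊗ₖ (sliceMap (reduceFst ω) (E₁.effect b) ⊗ₖ (1 : Matrix M₂ M₂ ℂ)) := by
  rw [sliceMap_winOp]
  refine Finset.sum_le_sum fun b _ => kronecker_mono_right (hP b) ?_
  rw [← sliceMap_regroup_one]
  exact sliceMap_mono hω.1 (regroup_mono_right (E₁.effect_nonneg b) (E₂.effect_le_one b))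

lemma sliceMap_winOp_le_snd {ω : Matrix (N₁ × N₂) (N₁ × N₂) ℂ} (hω : IsDensity ω)
    (hP : ∀ b, 0 ≤ P b) : sliceMap ω (winOp P E₁ E₂)
      ≤ ∑ b, P b ⊗ₖ ((1 : Matrix M₁ M₁ ℂ) ⊗ₖ sliceMap (reduceSnd ω) (E₂.effect b)) := by
  rw [sliceMap_winOp]
  refine Finset.sum_le_sum fun b _ => kronecker_mono_right (hP b) ?_
  rw [← sliceMap_one_regroup]
  exact sliceMap_mono hω.1 (regroup_mono_left (E₁.effect_le_one b) (E₂.effect_nonneg b))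

lemma sliceMap_nonneg {A B : Type*} [Fintype A] [Fintype B] [DecidableEq A] [DecidableEq B]
    {ω : Matrix B B ℂ} (hω : IsDensity ω) {T : Matrix (A × B) (A × B) ℂ} (hT : 0 ≤ T) :
    0 ≤ sliceMap ω T :=
  Matrix.nonneg_iff_posSemidef.2 (sliceMap_posSemidef hω.1 (Matrix.nonneg_iff_posSemidef.1 hT))

lemma sliceMap_le_one {A B : Type*} [Fintype A] [Fintype B] [DecidableEq A] [DecidableEq B]
    {ω : Matrix B B ℂ} (hω : IsDensity ω) {T : Matrix (A × B) (A × B) ℂ} (hT : T ≤ 1) :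
    sliceMap ω T ≤ 1 := by
  rw [← sliceMap_one hω.2]
  exact sliceMap_mono hω.1 hT

/-- The overlap of the slices of the success events for two different bases. -/
lemma sliceMap_winOp_overlap {N₁' N₂' : Type*} [Fintype N₁'] [Fintype N₂'] [DecidableEq N₁']
    [DecidableEq N₂'] {P' : β → Matrix R R ℂ} (E₁' : POVM (M₁ × N₁') β) (E₂' : POVM (M₂ × N₂') β)
    {ω : Matrix (N₁ × N₂) (N₁ × N₂) ℂ} {ω' : Matrix (N₁' × N₂') (N₁' × N₂') ℂ}
    (hω : IsDensity ω) (hω' : IsDensity ω') (hP : ∀ b, 0 ≤ P b) (hP' : ∀ b, 0 ≤ P' b) (c : β → β → ℝ) {C : ℝ}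
    (hC : 0 < C) (hc : ∀ b b', c b b' ≤ C) (hPP : ∀ b b', P b * P' b' * P b = c b b' • P b) :
    sliceMap ω (winOp P E₁ E₂) * sliceMap ω' (winOp P' E₁' E₂') * sliceMap ω (winOp P E₁ E₂)
      ≤ C • sliceMap ω (winOp P E₁ E₂) := by
  refine mul_mul_le_of_le (sliceMap_nonneg hω (winOp_nonneg E₁ E₂ hP))
    (sliceMap_nonneg hω' (winOp_nonneg E₁' E₂' hP')) (sliceMap_winOp_le_fst E₁ E₂ hω hP)
    (sliceMap_winOp_le_snd E₁' E₂' hω' hP') hC ?_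
  refine overlap_mul_mul_le hP hP' (fun b => sliceMap_nonneg hω.reduceFst (E₁.effect_nonneg b))
    (fun b => sliceMap_nonneg hω'.reduceSnd (E₂'.effect_nonneg b)) ?_ ?_ c hc hPP
  · rw [← sliceMap_sum, E₁.sum_effect, sliceMap_one hω.reduceFst.2]
  · rw [← sliceMap_sum, E₂'.sum_effect, sliceMap_one hω'.reduceSnd.2]

end Test

/-! ### Lower bounds for the mutual information -/

section Bounds

variable {A B M₁ M₂ N₁ : Type*} [Fintype A] [Fintype B] [Fintype M₁] [Fintype M₂] [Fintype N₁]
  [DecidableEq A] [DecidableEq B] [DecidableEq M₁] [DecidableEq M₂] [DecidableEq N₁]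

/-- Take T = 1 in the Lieb-type bound: its slice is again 1, and both logarithms vanish. -/
lemma mutualInfo_nonneg {ρ : Matrix (A × B) (A × B) ℂ} (hρ : IsDensity ρ) : 0 ≤ mutualInfo ρ := by
  have h := trace_mul_log_sub_le_mutualInfo hρ (T := 1) one_pos zero_le_one
    (by rw [one_smul]) (by rw [one_smul])
  rw [sliceMap_one hρ.reduceSnd.2] at h
  have h2 : cfc Real.log (1 : Matrix A A ℂ) = 0 := by
    simp
  have h3 : cfc Real.log (1 : Matrix (A × B) (A × B) ℂ) = 0 := by
    simp
  rw [h2, h3] at h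
  simpa using h

variable {n : ℕ} {N₂ : Bits n → Type*} [∀ q, Fintype (N₂ q)] [∀ q, DecidableEq (N₂ q)]

/-- The probability of the event that both measurements yield the outcome of the measurement, in
the basis labelled by `q`, of the reference system. -/
def winProb (ρ : Matrix (A × B) (A × B) ℂ) (V₁ : Matrix (Bits n × (M₁ × M₂)) A ℂ)
    (V₂ : ∀ q, Matrix (N₁ × N₂ q) B ℂ) (E₁ : Bits n → POVM (M₁ × N₁) (Bits n))
    (E₂ : ∀ q, POVM (M₂ × N₂ q) (Bits n)) (q : Bits n) : ℝ :=
  ((((V₁ ⊗ₖ V₂ q) * ρ * (V₁ ⊗ₖ V₂ q)ᴴ) * winOp (inputProj q) (E₁ q) (E₂ q)).trace).re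

/-- The success event for the basis labelled by `q`, averaged over the systems sent from the second
input point. -/
def winSlice (ρ : Matrix (A × B) (A × B) ℂ)
    (V₂ : ∀ q, Matrix (N₁ × N₂ q) B ℂ) (E₁ : Bits n → POVM (M₁ × N₁) (Bits n))
    (E₂ : ∀ q, POVM (M₂ × N₂ q) (Bits n)) (q : Bits n) :
    Matrix (Bits n × (M₁ × M₂)) (Bits n × (M₁ × M₂)) ℂ :=
  sliceMap (V₂ q * reduceSnd ρ * (V₂ q)ᴴ) (winOp (inputProj q) (E₁ q) (E₂ q))

variable {ρ : Matrix (A × B) (A × B) ℂ} (hρ : IsDensity ρ)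
  {V₁ : Matrix (Bits n × (M₁ × M₂)) A ℂ} (hV₁ : V₁ᴴ * V₁ = 1)
  {V₂ : ∀ q, Matrix (N₁ × N₂ q) B ℂ} (hV₂ : ∀ q, (V₂ q)ᴴ * V₂ q = 1)
  (E₁ : Bits n → POVM (M₁ × N₁) (Bits n)) (E₂ : ∀ q, POVM (M₂ × N₂ q) (Bits n))

include hρ hV₂ in
lemma winSlice_nonneg (q : Bits n) : 0 ≤ winSlice ρ V₂ E₁ E₂ q :=
  sliceMap_nonneg (hρ.reduceSnd.conj_isometry (hV₂ q)) (winOp_nonneg _ _ (inputProj_nonneg q))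

include hρ hV₂ in
lemma winSlice_le_one (q : Bits n) : winSlice ρ V₂ E₁ E₂ q ≤ 1 :=
  sliceMap_le_one (hρ.reduceSnd.conj_isometry (hV₂ q))
    (winOp_le_one _ _ (inputProj_nonneg q) (sum_inputProj q))

include hρ hV₂ in
lemma winSlice_overlap (q q' : Bits n) :
    winSlice ρ V₂ E₁ E₂ q * winSlice ρ V₂ E₁ E₂ q' * winSlice ρ V₂ E₁ E₂ q
      ≤ (basisOverlap q q' ^ 2) • winSlice ρ V₂ E₁ E₂ q :=
  sliceMap_winOp_overlap (E₁ q) (E₂ q) (E₁ q') (E₂ q') (hρ.reduceSnd.conj_isometry (hV₂ q))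
    (hρ.reduceSnd.conj_isometry (hV₂ q')) (inputProj_nonneg q) (inputProj_nonneg q') _
    (pow_pos (basisOverlap_pos q q') 2) (fun b b' => normSq_inputKets_dotProduct_le q q' b b')
    (fun b b' => inputProj_mul_mul q q' b b')

include hρ hV₁ hV₂ in
lemma winProb_le_one (q : Bits n) : winProb ρ V₁ V₂ E₁ E₂ q ≤ 1 := by
  have hd := hρ.conj_isometry (kronecker_isometry hV₁ (hV₂ q))
  have := trace_mul_le hd.1 (winOp_le_one (E₁ q) (E₂ q) (inputProj_nonneg q) (sum_inputProj q))
  rwa [Matrix.mul_one, hd.2, Complex.one_re] at this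

include hρ hV₁ hV₂ in
-- Apply the Lieb-type bound to the winning operator shifted by δ. The state V₁ ρ_A V₁ᴴ does not
-- depend on `q`, which makes the logarithmic terms for different `q` comparable.
lemma winProb_log_le_mutualInfo (q : Bits n) {δ : ℝ} (hδ : 0 < δ) :
    (1 - winProb ρ V₁ V₂ E₁ E₂ q) * Real.log δ - ((V₁ * reduceFst ρ * V₁ᴴ *
      cfc Real.log (winSlice ρ V₂ E₁ E₂ q + δ • (1 : Matrix _ _ ℂ))).trace).re
      ≤ mutualInfo ρ := by
  have hd := hρ.conj_isometry (kronecker_isometry hV₁ (hV₂ q))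
  have h0 := winOp_nonneg (E₁ q) (E₂ q) (inputProj_nonneg q)
  have h1 := winOp_le_one (E₁ q) (E₂ q) (inputProj_nonneg q) (sum_inputProj q)
  have h2 := mul_log_le_trace_mul_log_add h0 h1 hd hδ
  have h3 := trace_mul_log_sub_le_mutualInfo hd (T := winOp (inputProj q) (E₁ q) (E₂ q) + δ • 1)
    (κ := 1 + δ) hδ (by positivity) (le_add_of_nonneg_left h0)
    (by rw [add_smul, one_smul]; exact add_le_add h1 le_rfl)
  rw [mutualInfo_conj hV₁ (hV₂ q) hρ, reduceFst_conj V₁ (hV₂ q), reduceSnd_conj hV₁ (V₂ q),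
    sliceMap_add, sliceMap_smul, sliceMap_one (hρ.reduceSnd.conj_isometry (hV₂ q)).2] at h3
  unfold winProb winSlice
  linarith

include hρ hV₁ hV₂ in
/-- The lower bound on the mutual information from the uncertainty relation. -/
lemma uncertainty_le_mutualInfo (hn : 1 ≤ n) {ε : ℝ}
    (hε : 1 - ε ≤ (∑ q, winProb ρ V₁ V₂ E₁ E₂ q) / 2 ^ n) :
    Real.log 2 * (n / 2 - ε * n - 1) ≤ mutualInfo ρ := by
  -- The squared overlap of the bases labelled by complementary strings. The assumption n ≥ 1 gives
  -- δ ≤ 1/2.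
  set δ : ℝ := (1 / 2) ^ n with hδ
  have hδ0 : 0 < δ := by positivity
  have hδ2 : δ ≤ 1 / 2 := by
    have := pow_le_pow_of_le_one (by norm_num : (0 : ℝ) ≤ 1 / 2) (by norm_num) hn
    simpa [hδ] using this
  have hlogδ : Real.log δ = -(n * Real.log 2) := by
    rw [hδ, Real.log_pow, one_div, Real.log_inv]; ring
  set g : Bits n → ℝ := fun q => ((V₁ * reduceFst ρ * V₁ᴴ *
      cfc Real.log (winSlice ρ V₂ E₁ E₂ q + δ • (1 : Matrix _ _ ℂ))).trace).re with hg
  have hα := hρ.reduceFst.conj_isometry hV₁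
  -- Subtraction from 1 flips every bit. As `e` is a bijection, summing over the pairs (q, e q)
  -- counts every slice twice.
  let e : Bits n ≃ Bits n := Equiv.piCongrRight fun _ => Equiv.subLeft 1
  have hpair : ∀ q, g q + g (e q) ≤ Real.log (4 * δ) := by
    intro q
    refine trace_mul_log_add_le (winSlice_nonneg hρ hV₂ E₁ E₂ q) (winSlice_le_one hρ hV₂ E₁ E₂ q)
      (winSlice_nonneg hρ hV₂ E₁ E₂ _) (winSlice_le_one hρ hV₂ E₁ E₂ _) hδ0 hδ2 ?_ hα
    have := winSlice_overlap hρ hV₂ E₁ E₂ q (e q)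
    rwa [show basisOverlap q (e q) ^ 2 = δ from basisOverlap_complement q] at this
  have hsum : ∑ q, (g q + g (e q)) = 2 * ∑ q, g q := by
    rw [Finset.sum_add_distrib, Equiv.sum_comp e g, two_mul]
  have hcard : (Finset.univ : Finset (Bits n)).card = 2 ^ n := by simp
  have hle : 2 * ∑ q, g q ≤ 2 ^ n * Real.log (4 * δ) := by
    rw [← hsum]
    refine (Finset.sum_le_sum fun q _ => hpair q).trans (le_of_eq ?_)
    rw [Finset.sum_const, hcard]; simp
  have hI := Finset.sum_le_sum fun q (_ : q ∈ Finset.univ) =>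
    winProb_log_le_mutualInfo hρ hV₁ hV₂ E₁ E₂ q hδ0
  rw [Finset.sum_sub_distrib, ← Finset.sum_mul, Finset.sum_sub_distrib, Finset.sum_const,
    Finset.sum_const, hcard] at hI
  simp only [nsmul_eq_mul, mul_one, Nat.cast_pow, Nat.cast_ofNat] at hI
  have hp : (0 : ℝ) < 2 ^ n := by positivity
  rw [le_div_iff₀ hp] at hε
  have hlog4 : Real.log (4 * δ) = 2 * Real.log 2 - n * Real.log 2 := by
    rw [Real.log_mul (by norm_num) hδ0.ne', hlogδ, show (4 : ℝ) = 2 ^ 2 by norm_num, Real.log_pow]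
    push_cast; ring
  have hl2 : 0 ≤ Real.log 2 := Real.log_nonneg (by norm_num)
  have h1 : (2 ^ n - ∑ q, winProb ρ V₁ V₂ E₁ E₂ q) * (n * Real.log 2)
      ≤ (ε * 2 ^ n) * (n * Real.log 2) :=
    mul_le_mul_of_nonneg_right (by linarith) (by positivity)
  refine le_of_mul_le_mul_left ?_ hp
  rw [hlog4] at hle
  rw [hlogδ] at hI
  have h2 : (2 : ℝ) ^ n * (Real.log 2 * (n / 2 - ε * n - 1))
      = -((ε * 2 ^ n) * (n * Real.log 2)) - 2 ^ n * (2 * Real.log 2 - n * Real.log 2) / 2 := by ring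
  rw [h2]
  have h3 : ∑ q, g q = ∑ q, ((V₁ * reduceFst ρ * V₁ᴴ *
      cfc Real.log (winSlice ρ V₂ E₁ E₂ q + δ • (1 : Matrix _ _ ℂ))).trace).re := rfl
  linarith

include hρ hV₁ hV₂ in
/-- The lower bound on the mutual information from the monogamy of entanglement game. -/
lemma monogamy_le_mutualInfo {ε : ℝ}
    (hε : 1 - ε ≤ (∑ q, winProb ρ V₁ V₂ E₁ E₂ q) / 2 ^ n) {t : ℝ}
    (ht : t = ((1 + (√2)⁻¹) / 2) ^ n) (ht1 : t ≤ 1) :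
    ε * Real.log t - Real.log (2 * t) ≤ mutualInfo ρ := by
  have ht0 : 0 < t := by rw [ht]; positivity
  have hα := hρ.reduceFst.conj_isometry hV₁
  set α := V₁ * reduceFst ρ * V₁ᴴ with hαdef
  set X := winSlice ρ V₂ E₁ E₂ with hX
  have hcard : (Finset.univ : Finset (Bits n)).card = 2 ^ n := by simp
  have hp : (0 : ℝ) < 2 ^ n := by positivity
  have hL : (0 : ℝ) < (1 + (√2)⁻¹) ^ n := by positivity
  have hsum := sum_le_smul_one_of_overlap X (winSlice_nonneg hρ hV₂ E₁ E₂) basisOverlap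
    basisOverlap_pos basisOverlap_comm (winSlice_overlap hρ hV₂ E₁ E₂) hL
    (fun q => (sum_basisOverlap q).le)
  have htr := trace_mul_le hα.1 hsum
  rw [Finset.mul_sum, Matrix.trace_sum, Complex.re_sum, Matrix.mul_smul, Matrix.mul_one,
    Matrix.trace_smul, hα.2, Complex.smul_re, Complex.one_re, smul_eq_mul, mul_one] at htr
  have hLt : (1 + (√2)⁻¹) ^ n = 2 ^ n * t := by
    rw [ht, div_pow]; field_simp
  have hg : ∀ q, ((α * cfc Real.log (X q + t • (1 : Matrix _ _ ℂ))).trace).re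
      ≤ Real.log (2 * t) + (((α * X q).trace).re + t) / (2 * t) - 1 := by
    intro q
    -- The tangent point 2t bounds the average over q of the expectation of X_q + t: the operator
    -- norm bound contributes one t and the shift the other. On average only log(2t) remains.
    have h := trace_mul_log_le (posDef_of_smul_one_le ht0
      (le_add_of_nonneg_left (winSlice_nonneg hρ hV₂ E₁ E₂ q))) hα (m := 2 * t) (by positivity)
    rwa [Matrix.mul_add, Matrix.trace_add, Complex.add_re, Matrix.mul_smul, Matrix.mul_one,
      Matrix.trace_smul, hα.2, Complex.smul_re, Complex.one_re, smul_eq_mul, mul_one] at h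
  have hgs := Finset.sum_le_sum fun q (_ : q ∈ Finset.univ) => hg q
  rw [Finset.sum_sub_distrib, Finset.sum_add_distrib, ← Finset.sum_div, Finset.sum_add_distrib,
    Finset.sum_const, Finset.sum_const, Finset.sum_const, hcard] at hgs
  simp only [nsmul_eq_mul, mul_one, Nat.cast_pow, Nat.cast_ofNat] at hgs
  have h1 : (∑ q, ((α * X q).trace).re + 2 ^ n * t) / (2 * t) ≤ 2 ^ n := by
    rw [div_le_iff₀ (by positivity)]
    rw [hLt] at htr
    linarith
  have hI := Finset.sum_le_sum fun q (_ : q ∈ Finset.univ) =>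
    winProb_log_le_mutualInfo hρ hV₁ hV₂ E₁ E₂ q ht0
  rw [Finset.sum_sub_distrib, ← Finset.sum_mul, Finset.sum_sub_distrib, Finset.sum_const,
    Finset.sum_const, hcard] at hI
  simp only [nsmul_eq_mul, mul_one, Nat.cast_pow, Nat.cast_ofNat] at hI
  rw [le_div_iff₀ hp] at hε
  have hlt : Real.log t ≤ 0 := Real.log_nonpos ht0.le ht1
  have h2 : (ε * 2 ^ n) * Real.log t ≤ (2 ^ n - ∑ q, winProb ρ V₁ V₂ E₁ E₂ q) * Real.log t :=
    mul_le_mul_of_nonpos_right (by linarith) hlt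
  refine le_of_mul_le_mul_left ?_ hp
  have h3 : (2 : ℝ) ^ n * (ε * Real.log t - Real.log (2 * t))
      = (ε * 2 ^ n) * Real.log t - 2 ^ n * Real.log (2 * t) := by ring
  rw [h3]
  linarith

end Bounds

/-! ### Numerical estimates -/

lemma cos_sq_pi_div_eight : Real.cos (Real.pi / 8) ^ 2 = (1 + (√2)⁻¹) / 2 := by
  rw [Real.cos_pi_div_eight, div_pow, Real.sq_sqrt (by positivity)]
  have h : (√2)⁻¹ = √2 / 2 := by
    rw [inv_eq_one_div, div_eq_div_iff (by positivity) (by norm_num), Real.mul_self_sqrt (by norm_num),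
      one_mul]
  rw [h]; ring

lemma sqrt_two_inv_bounds : (0.707 : ℝ) < (√2)⁻¹ ∧ (√2)⁻¹ < 0.7072 := by
  have h1 : (1.4142 : ℝ) < √2 := Real.lt_sqrt_of_sq_lt (by norm_num)
  have h2 : √2 < (1.4143 : ℝ) := (Real.sqrt_lt' (by norm_num)).2 (by norm_num)
  refine ⟨?_, ?_⟩
  · refine lt_of_lt_of_le ?_ (inv_anti₀ (by positivity) h2.le)
    norm_num
  · refine lt_of_le_of_lt (inv_anti₀ (by norm_num) h1.le) ?_
    norm_num

/-- An affine function plus a logarithm is nonnegative on an interval if it is so at both ends. -/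
lemma affine_add_log_nonneg {a b x y s : ℝ} (hx : 0 < x) (hxs : x ≤ s) (hsy : s ≤ y)
    (h₁ : 0 ≤ a + b * x + 2 * Real.log (2 * x)) (h₂ : 0 ≤ a + b * y + 2 * Real.log (2 * y)) :
    0 ≤ a + b * s + 2 * Real.log (2 * s) := by
  obtain ⟨u, v, hu, hv, huv, rfl⟩ := (Convex.mem_Icc (hxs.trans hsy)).1 ⟨hxs, hsy⟩
  have hy := hx.trans_le (hxs.trans hsy)
  have h := strictConcaveOn_log_Ioi.concaveOn.2 (Set.mem_Ioi.2 (show 0 < 2 * x by positivity))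
    (Set.mem_Ioi.2 (show 0 < 2 * y by positivity)) hu hv huv
  simp only [smul_eq_mul] at h
  have e : u * (2 * x) + v * (2 * y) = 2 * (u * x + v * y) := by ring
  rw [e] at h
  have ha : a = u * a + v * a := by rw [← add_mul, huv, one_mul]
  have := mul_nonneg hu h₁
  have := mul_nonneg hv h₂
  nlinarith

/-- With t = β^n and s = ε + t the claim is I + 2 log(2s) ≥ 0. For s ≥ 1/2 it follows from I ≥ 0.
Otherwise `hU` bounds the left side below by a concave function of s, to be checked only at the ends
of an interval starting at t. The bound `hM` handles n ≥ 17 with s between 2/5 and 1/2, where `hU`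
can be too weak. -/
lemma neg_log_le_half_of_bounds {n : ℕ} {ε I β : ℝ} (hβ₁ : (0.8535 : ℝ) < β) (hβ₂ : β < 0.8536)
    (hε : 0 ≤ ε) (hI : 0 ≤ I)
    (hU : 1 ≤ n → Real.log 2 * (n / 2 - ε * n - 1) ≤ I)
    (hM : ε * Real.log (β ^ n) - Real.log (2 * β ^ n) ≤ I) :
    -Real.log (2 * (ε + β ^ n)) ≤ (1 / 2) * I := by
  have hβ0 : 0 < β := by linarith
  set t := β ^ n with ht
  have ht0 : 0 < t := by positivity
  set s := ε + t with hs
  have hts : t ≤ s := by linarith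
  have hs0 : 0 < s := by linarith
  rcases le_or_gt (1 / 2) s with h | h
  · have := Real.log_nonneg (show (1 : ℝ) ≤ 2 * s by linarith)
    linarith
  have hpowge : ∀ k, (0.8535 : ℝ) ^ k ≤ β ^ k := fun k =>
    pow_le_pow_left₀ (by norm_num) hβ₁.le k
  -- β⁴ exceeds 1/2, whereas t ≤ s < 1/2.
  have hn5 : 5 ≤ n := by
    by_contra hn
    have h4 : β ^ 4 ≤ β ^ n := pow_le_pow_of_le_one hβ0.le (by linarith) (by omega)
    have := hpowge 4
    norm_num at this
    linarith
  have hU := hU (by omega)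
  have hl2 : 0 < Real.log 2 := Real.log_pos (by norm_num)
  suffices hmain : 0 ≤ I + 2 * Real.log (2 * s) by linarith
  have hlogt : Real.log t = n * Real.log β := by rw [ht, Real.log_pow]
  -- The left end s = t, that is ε = 0: the value is (n/2)(log 2 + 4 log β) + log 2, nonnegative
  -- because 2β⁴ ≥ 1.
  have hstart : 0 ≤ Real.log 2 * (n / 2 + t * n - 1) + (-(Real.log 2 * n)) * t
      + 2 * Real.log (2 * t) := by
    have h1 : 0 ≤ Real.log 2 + 4 * Real.log β := by
      have e : Real.log 2 + 4 * Real.log β = Real.log (2 * β ^ 4) := by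
        rw [Real.log_mul (by norm_num) (by positivity), Real.log_pow]; norm_num
      rw [e]
      refine Real.log_nonneg ?_
      have := hpowge 4
      norm_num at this
      linarith
    rw [Real.log_mul (by norm_num) ht0.ne', hlogt]
    have : 0 ≤ (n : ℝ) * (Real.log 2 + 4 * Real.log β) := by positivity
    nlinarith
  have hfin : ∀ y, s ≤ y → 0 ≤ Real.log 2 * (n / 2 + t * n - 1) + (-(Real.log 2 * n)) * y
      + 2 * Real.log (2 * y) → 0 ≤ I + 2 * Real.log (2 * s) := by
    intro y hsy hy
    have := affine_add_log_nonneg ht0 hts hsy hstart hy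
    have e : Real.log 2 * (n / 2 - ε * n - 1)
        = Real.log 2 * (n / 2 + t * n - 1) + (-(Real.log 2 * n)) * s := by
      rw [hs]; ring
    linarith
  rcases le_or_gt n 16 with hn16 | hn16
  · refine hfin (1 / 2) h.le ?_
    -- At the right end s = 1/2 the logarithm vanishes and log 2 (nt − 1) remains; nβ^n ≥ 1 holds
    -- for 5 ≤ n ≤ 16.
    have hnt : 1 ≤ n * t := by
      have h1 : (1 : ℝ) ≤ n * 0.8535 ^ n := by
        clear_value t s
        interval_cases n <;> norm_num
      exact h1.trans (mul_le_mul_of_nonneg_left (hpowge n) (by positivity))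
    rw [show (2 : ℝ) * (1 / 2) = 1 by norm_num, Real.log_one]
    have := mul_nonneg hl2.le (sub_nonneg.2 hnt)
    linarith
  · have hn17 : (17 : ℝ) ≤ n := by exact_mod_cast hn16
    rcases le_or_gt s (2 / 5) with h25 | h25
    -- At s = 2/5 the value is at least log 2 (n/10 − 1) − 2 log(5/4). For n ≥ 17 it suffices that 2
    -- log(5/4) ≤ 0.7 log 2, that is (5/4)^20 ≤ 2^7.
    · refine hfin (2 / 5) h25 ?_
      have h1 : Real.log (2 * (2 / 5)) = -Real.log (5 / 4) := by
        rw [← Real.log_inv]; norm_num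
      have h2 : 20 * Real.log (5 / 4) ≤ 7 * Real.log 2 := by
        have := Real.log_le_log (by positivity) (show ((5 : ℝ) / 4) ^ 20 ≤ 2 ^ 7 by norm_num)
        rw [Real.log_pow, Real.log_pow] at this
        exact_mod_cast this
      rw [h1]
      have h3 : 0 ≤ Real.log 2 * (n - 17) := mul_nonneg hl2.le (by linarith)
      have h4 : 0 ≤ Real.log 2 * (t * n) := by positivity
      linarith
    -- Since ε < 1/2, `hM` gives I ≥ −(1/2) log t − log 2. With t ≤ 1/10 and s > 2/5 the claim
    -- reduces to 4/10 ≤ (4/5)⁴.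
    · have ht10 : t ≤ 1 / 10 := by
        have h1 : t ≤ β ^ 17 := pow_le_pow_of_le_one hβ0.le (by linarith) (by omega)
        have h2 : β ^ 17 ≤ 0.8536 ^ 17 := pow_le_pow_left₀ hβ0.le hβ₂.le 17
        have h3 : (0.8536 : ℝ) ^ 17 ≤ 1 / 10 := by norm_num
        linarith
      have hlt : Real.log t ≤ 0 := Real.log_nonpos ht0.le (by linarith)
      have h1 : 1 / 2 * Real.log t ≤ ε * Real.log t :=
        mul_le_mul_of_nonpos_right (by linarith) hlt
      rw [Real.log_mul (by norm_num) ht0.ne'] at hM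
      have h2 : Real.log (4 / 5) ≤ Real.log (2 * s) := Real.log_le_log (by norm_num) (by linarith)
      have h3 : Real.log t ≤ Real.log (1 / 10) := Real.log_le_log ht0 ht10
      have h4 : 2 * Real.log 2 + Real.log (1 / 10) ≤ 4 * Real.log (4 / 5) := by
        have := Real.log_le_log (by positivity)
          (show ((2 : ℝ)) ^ 2 * (1 / 10) ≤ (4 / 5) ^ 4 by norm_num)
        rw [Real.log_mul (by positivity) (by positivity), Real.log_pow, Real.log_pow] at this
        exact_mod_cast this
      linarith

/-! ### Dilation of a protocol -/

section Dilation

variable {n : ℕ} {A B M₁ M₂ N₁ N₂ : Type*}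
  [Fintype A] [Fintype B] [Fintype M₁] [Fintype M₂] [Fintype N₁] [Fintype N₂]
  [DecidableEq A] [DecidableEq B] [DecidableEq M₁] [DecidableEq M₂]
  [DecidableEq N₁] [DecidableEq N₂]

/-- The Stinespring isometry of a channel to a composite system, the environment being joined to
the second output. -/
def Channel.dilation {Y₁ Y₂ : Type*} [Fintype Y₁] [Fintype Y₂] (Φ : Channel B (Y₁ × Y₂)) :
    Matrix (Y₁ × (Y₂ × Fin Φ.num)) B ℂ :=
  Matrix.of fun y b => Φ.kraus y.2.2 (y.1, y.2.1) b

lemma Channel.sum_star_kraus_mul {X Y : Type*} [Fintype X] [Fintype Y] [DecidableEq X]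
    (Φ : Channel X Y) (x x' : X) :
    ∑ k, ∑ y, star (Φ.kraus k y x) * Φ.kraus k y x' = if x = x' then 1 else 0 := by
  have h := congrFun (congrFun Φ.sum_kraus x) x'
  rw [Matrix.sum_apply, Matrix.one_apply] at h
  rw [← h]
  simp [Matrix.mul_apply, Matrix.conjTranspose_apply]

lemma Channel.dilation_isometry {Y₁ Y₂ : Type*} [Fintype Y₁] [Fintype Y₂]
    (Φ : Channel B (Y₁ × Y₂)) : Φ.dilationᴴ * Φ.dilation = 1 := by
  ext b b'
  rw [Matrix.one_apply, ← Φ.sum_star_kraus_mul b b', Matrix.mul_apply]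
  simp only [Fintype.sum_prod_type, Matrix.conjTranspose_apply, Channel.dilation, Matrix.of_apply]
  rw [Finset.sum_comm_cycle]

/-- The isometry that applies the Stinespring dilation of a channel to one half of a maximally
entangled state and to the system `A`. -/
def Channel.entangledDilation (Φ : Channel (Bits n × A) (M₁ × M₂)) :
    Matrix (Bits n × (M₁ × (M₂ × Fin Φ.num))) A ℂ :=
  Matrix.of fun y a => (((√2)⁻¹ ^ n : ℝ) : ℂ) * Φ.kraus y.2.2.2 (y.2.1, y.2.2.1) (y.1, a)

lemma sqrt_two_inv_pow_mul_self (n : ℕ) :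
    (((√2)⁻¹ ^ n : ℝ) : ℂ) * (((√2)⁻¹ ^ n : ℝ) : ℂ) = (1 / 2) ^ n := by
  rw [← Complex.ofReal_mul, ← mul_pow, sqrt_two_inv_sq]
  push_cast
  rfl

lemma Channel.entangledDilation_isometry (Φ : Channel (Bits n × A) (M₁ × M₂)) :
    Φ.entangledDilationᴴ * Φ.entangledDilation = 1 := by
  ext a a'
  have h : ∀ r : Bits n, ∑ k, ∑ y, star (Φ.kraus k y (r, a)) * Φ.kraus k y (r, a')
      = if a = a' then 1 else 0 := fun r => by
    rw [Φ.sum_star_kraus_mul]; simp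
  have e : (Φ.entangledDilationᴴ * Φ.entangledDilation) a a'
      = (1 / 2) ^ n * ∑ r : Bits n, ∑ k, ∑ y, star (Φ.kraus k y (r, a)) * Φ.kraus k y (r, a') := by
    rw [Matrix.mul_apply, Fintype.sum_prod_type, Finset.mul_sum]
    refine Finset.sum_congr rfl fun r _ => ?_
    simp only [Fintype.sum_prod_type, Matrix.conjTranspose_apply, Channel.entangledDilation,
      Matrix.of_apply, Finset.mul_sum, star_mul', Complex.star_def, Complex.conj_ofReal]
    rw [Finset.sum_comm_cycle]
    refine Finset.sum_congr rfl fun k _ => Finset.sum_congr rfl fun m₁ _ =>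
      Finset.sum_congr rfl fun m₂ _ => ?_
    rw [← sqrt_two_inv_pow_mul_self]
    ring
  rw [e, Finset.sum_congr rfl fun r _ => h r, Finset.sum_const, Finset.card_univ, Matrix.one_apply]
  have hc : (Fintype.card (Bits n) : ℂ) = 2 ^ n := by simp
  split_ifs
  · rw [nsmul_eq_mul, hc, mul_one, ← mul_pow]; norm_num
  · simp

/-- The extension of a measurement by a trivial one on an additional system. -/
def POVM.extend {K L O : Type*} [Fintype K] [Fintype L] [DecidableEq K] [DecidableEq L] [Fintype O]
    (E : POVM (M₂ × N₂) O) : POVM ((M₂ × K) × (N₂ × L)) O where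
  effect o := regroup (E.effect o) (1 : Matrix (K × L) (K × L) ℂ)
  posSemidef o := Matrix.nonneg_iff_posSemidef.1 (regroup_nonneg (E.effect_nonneg o) zero_le_one)
  sum_effect := by
    rw [← regroup_one_one, ← E.sum_effect]
    ext
    simp [regroup, Matrix.sum_apply, Finset.sum_mul]

/-- The operator taking the resource to the outputs, for one Kraus operator at each of the input
points and a ket received at the first one. -/
def branchOp (K : Matrix (M₁ × M₂) (Bits n × A) ℂ) (L : Matrix (N₁ × N₂) B ℂ) (ψ : Bits n → ℂ) :
    Matrix ((M₁ × M₂) × (N₁ × N₂)) (A × B) ℂ :=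
  (Matrix.of fun m a => ∑ r, ψ r * K m (r, a)) ⊗ₖ L

lemma kronecker_mul_input_mul (K : Matrix (M₁ × M₂) (Bits n × A) ℂ) (L : Matrix (N₁ × N₂) B ℂ)
    (ψ : Bits n → ℂ) (ρ : Matrix (A × B) (A × B) ℂ) :
    (K ⊗ₖ L) * Matrix.reindex (Equiv.prodAssoc (Bits n) A B).symm
      (Equiv.prodAssoc (Bits n) A B).symm (Matrix.vecMulVec ψ (star ψ) ⊗ₖ ρ) * (K ⊗ₖ L)ᴴ
      = branchOp K L ψ * ρ * (branchOp K L ψ)ᴴ := by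
  let Ψ : Matrix ((Bits n × A) × B) (A × B) ℂ :=
    (Matrix.of fun x a => ψ x.1 * (1 : Matrix A A ℂ) x.2 a) ⊗ₖ (1 : Matrix B B ℂ)
  have h1 : Matrix.reindex (Equiv.prodAssoc (Bits n) A B).symm
      (Equiv.prodAssoc (Bits n) A B).symm (Matrix.vecMulVec ψ (star ψ) ⊗ₖ ρ) = Ψ * ρ * Ψᴴ := by
    ext ⟨⟨r, a⟩, b⟩ ⟨⟨r', a'⟩, b'⟩
    simp only [Ψ, Matrix.mul_apply, Fintype.sum_prod_type, Matrix.conjTranspose_apply,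
      Matrix.kronecker_apply, Matrix.of_apply, Matrix.one_apply, Matrix.reindex_apply,
      Matrix.submatrix_apply, Matrix.vecMulVec_apply, Equiv.symm_symm, Equiv.prodAssoc_apply,
      Pi.star_apply, mul_ite, ite_mul, mul_one, mul_zero, zero_mul, Finset.sum_ite_eq,
      Finset.mem_univ, if_true, apply_ite star, star_zero]
    ring
  have h2 : (K ⊗ₖ L) * Ψ = branchOp K L ψ := by
    simp only [Ψ, branchOp]
    rw [← Matrix.mul_kronecker_mul, Matrix.mul_one]
    congr 1
    ext m a
    simp only [Matrix.mul_apply, Fintype.sum_prod_type, Matrix.of_apply, Matrix.one_apply, mul_ite,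
      mul_one, mul_zero, Finset.sum_ite_eq', Finset.mem_univ, if_true]
    exact Finset.sum_congr rfl fun r _ => mul_comm _ _
  rw [h1, ← h2, Matrix.conjTranspose_mul]
  simp only [Matrix.mul_assoc]

lemma trace_dilation_mul (Φ : Channel (Bits n × A) (M₁ × M₂)) (Ψ : Channel B (N₁ × N₂))
    (ρ : Matrix (A × B) (A × B) ℂ) (ψ : Bits n → ℂ) (E₁ : Matrix (M₁ × N₁) (M₁ × N₁) ℂ)
    (E₂ : Matrix (M₂ × N₂) (M₂ × N₂) ℂ) :
    (((Φ.entangledDilation ⊗ₖ Ψ.dilation) * ρ * (Φ.entangledDilation ⊗ₖ Ψ.dilation)ᴴ) *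
      (Matrix.vecMulVec (star ψ) ψ ⊗ₖ regroup E₁
        (regroup E₂ (1 : Matrix (Fin Φ.num × Fin Ψ.num) (Fin Φ.num × Fin Ψ.num) ℂ))).submatrix
          (Equiv.prodAssoc (Bits n) _ _) (Equiv.prodAssoc (Bits n) _ _)).trace
      = (1 / 2) ^ n * ∑ k, ∑ l, (regroup E₁ E₂ * (branchOp (Φ.kraus k) (Ψ.kraus l) ψ * ρ *
        (branchOp (Φ.kraus k) (Ψ.kraus l) ψ)ᴴ)).trace := by
  -- `D₁ k` contracts the reference with ψ and selects the index k of the environment; `D₂ l`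
  -- selects the index l. Composed with the isometries they return the individual Kraus branches,
  -- and summing D* E D over them, where E is the joint effect, rebuilds the extended test.
  let D₁ : Fin Φ.num → Matrix (M₁ × M₂) (Bits n × (M₁ × (M₂ × Fin Φ.num))) ℂ := fun k =>
    Matrix.of fun m x => ψ x.1 * ((1 : Matrix M₁ M₁ ℂ) m.1 x.2.1 *
      ((1 : Matrix M₂ M₂ ℂ) m.2 x.2.2.1 * (1 : Matrix (Fin Φ.num) (Fin Φ.num) ℂ) k x.2.2.2))
  let D₂ : Fin Ψ.num → Matrix (N₁ × N₂) (N₁ × (N₂ × Fin Ψ.num)) ℂ := fun l =>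
    Matrix.of fun m x => (1 : Matrix N₁ N₁ ℂ) m.1 x.1 *
      ((1 : Matrix N₂ N₂ ℂ) m.2 x.2.1 * (1 : Matrix (Fin Ψ.num) (Fin Ψ.num) ℂ) l x.2.2)
  have hD₁ : ∀ k, D₁ k * Φ.entangledDilation = (((√2)⁻¹ ^ n : ℝ) : ℂ) •
      (Matrix.of fun m a => ∑ r, ψ r * Φ.kraus k m (r, a)) := by
    intro k
    ext ⟨m₁, m₂⟩ a
    simp only [D₁, Matrix.mul_apply, Fintype.sum_prod_type, Channel.entangledDilation,
      Matrix.of_apply, Matrix.one_apply, mul_ite, ite_mul, mul_one, mul_zero, zero_mul,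
      Finset.sum_ite_eq, Finset.mem_univ, if_true, Matrix.smul_apply, smul_eq_mul,
      Finset.mul_sum]
    exact Finset.sum_congr rfl fun r _ => by ring
  have hD₂ : ∀ l, D₂ l * Ψ.dilation = Ψ.kraus l := by
    intro l
    ext ⟨m₁, m₂⟩ a
    simp only [D₂, Matrix.mul_apply, Fintype.sum_prod_type, Channel.dilation,
      Matrix.of_apply, Matrix.one_apply, mul_ite, ite_mul, mul_one, one_mul, mul_zero, zero_mul,
      Finset.sum_ite_eq, Finset.mem_univ, if_true]
  have hD : ∀ k l, (D₁ k ⊗ₖ D₂ l) * (Φ.entangledDilation ⊗ₖ Ψ.dilation)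
      = (((√2)⁻¹ ^ n : ℝ) : ℂ) • branchOp (Φ.kraus k) (Ψ.kraus l) ψ := by
    intro k l
    rw [← Matrix.mul_kronecker_mul, hD₁, hD₂, Matrix.smul_kronecker, branchOp]
  have hW : (Matrix.vecMulVec (star ψ) ψ ⊗ₖ regroup E₁
        (regroup E₂ (1 : Matrix (Fin Φ.num × Fin Ψ.num) (Fin Φ.num × Fin Ψ.num) ℂ))).submatrix
          (Equiv.prodAssoc (Bits n) _ _) (Equiv.prodAssoc (Bits n) _ _)
      = ∑ k, ∑ l, (D₁ k ⊗ₖ D₂ l)ᴴ * regroup E₁ E₂ * (D₁ k ⊗ₖ D₂ l) := by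
    ext ⟨⟨r, m₁, m₂, k⟩, n₁, n₂, l⟩ ⟨⟨r', m₁', m₂', k'⟩, n₁', n₂', l'⟩
    simp only [Matrix.sum_apply, D₁, D₂, Matrix.mul_apply, Fintype.sum_prod_type,
      Matrix.conjTranspose_apply, Matrix.kronecker_apply, Matrix.of_apply, Matrix.one_apply,
      Matrix.submatrix_apply, Equiv.prodAssoc_apply, regroup, Equiv.prodProdProdComm_apply,
      Matrix.vecMulVec_apply, Pi.star_apply, Prod.mk.injEq, apply_ite star, star_zero, mul_ite,
      ite_mul, mul_one, mul_zero, zero_mul, Finset.sum_ite_eq', Finset.sum_ite_irrel, Finset.sum_const_zero, Finset.mem_univ, if_true]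
    split_ifs <;> simp_all
    ring
  rw [hW, Finset.mul_sum, Finset.mul_sum, Matrix.trace_sum]
  refine Finset.sum_congr rfl fun k _ => ?_
  rw [Finset.mul_sum, Finset.mul_sum, Matrix.trace_sum]
  refine Finset.sum_congr rfl fun l _ => ?_
  have e : (D₁ k ⊗ₖ D₂ l) * ((Φ.entangledDilation ⊗ₖ Ψ.dilation) * ρ *
      (Φ.entangledDilation ⊗ₖ Ψ.dilation)ᴴ) * (D₁ k ⊗ₖ D₂ l)ᴴ
      = ((1 / 2 : ℂ) ^ n) • (branchOp (Φ.kraus k) (Ψ.kraus l) ψ * ρ *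
        (branchOp (Φ.kraus k) (Ψ.kraus l) ψ)ᴴ) := by
    have : (D₁ k ⊗ₖ D₂ l) * ((Φ.entangledDilation ⊗ₖ Ψ.dilation) * ρ *
      (Φ.entangledDilation ⊗ₖ Ψ.dilation)ᴴ) * (D₁ k ⊗ₖ D₂ l)ᴴ
      = ((D₁ k ⊗ₖ D₂ l) * (Φ.entangledDilation ⊗ₖ Ψ.dilation)) * ρ *
        ((D₁ k ⊗ₖ D₂ l) * (Φ.entangledDilation ⊗ₖ Ψ.dilation))ᴴ := by
      rw [Matrix.conjTranspose_mul]
      simp only [Matrix.mul_assoc]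
    rw [this, hD, Matrix.conjTranspose_smul, Matrix.smul_mul, Matrix.smul_mul, Matrix.mul_smul,
      smul_smul, Complex.star_def, Complex.conj_ofReal, sqrt_two_inv_pow_mul_self]
  rw [← smul_eq_mul ((1 / 2 : ℂ) ^ n), ← Matrix.trace_smul, ← Matrix.mul_smul, ← e,
    Matrix.trace_mul_comm, Matrix.mul_assoc, Matrix.mul_assoc, Matrix.trace_mul_comm]
  simp only [Matrix.mul_assoc]

lemma trace_mul_reindex {X Y : Type*} [Fintype X] [Fintype Y] (e : X ≃ Y) (S : Matrix Y Y ℂ)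
    (T : Matrix X X ℂ) : (S * Matrix.reindex e e T).trace = (S.submatrix e e * T).trace := by
  simp only [Matrix.trace, Matrix.diag, Matrix.mul_apply, Matrix.reindex_apply,
    Matrix.submatrix_apply]
  rw [← Equiv.sum_comp e]
  refine Finset.sum_congr rfl fun x _ => ?_
  rw [← Equiv.sum_comp e]
  simp

/-- Projecting the reference onto the transposed input state prepares that input with probability
2^{-n}, and the trivial extension of the second measurement traces out both environments. The
environment at c₂ may vary with `q`, hence the `q`-dependent system in `winProb`. -/
lemma winProb_eq_sum_successProbOn (P : Protocol n A B M₁ M₂ N₁ N₂) (ρ : Matrix (A × B) (A × B) ℂ)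
    (q : Bits n) :
    winProb ρ P.opFst.entangledDilation (fun q => (P.opSnd q).dilation) P.measFst
      (fun q => (P.measSnd q).extend (K := Fin P.opFst.num) (L := Fin (P.opSnd q).num)) q
      = (1 / 2) ^ n * ∑ b, P.successProbOn ρ q b := by
  rw [winProb, winOp, Finset.mul_sum, Matrix.trace_sum, Complex.re_sum, Finset.mul_sum]
  refine Finset.sum_congr rfl fun b _ => ?_
  rw [inputProj_eq]
  simp only [POVM.extend]
  rw [trace_dilation_mul, Protocol.successProbOn, Protocol.finalState, trace_mul_reindex,
    Channel.applyProd, inputState]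
  simp only [kronecker_mul_input_mul, Finset.mul_sum, Matrix.trace_sum]
  simp only [← Finset.mul_sum, regroup]
  rw [show ((1 / 2 : ℂ) ^ n) = (((1 / 2 : ℝ) ^ n : ℝ) : ℂ) by push_cast; rfl, Complex.re_ofReal_mul]

end Dilation

theorem Protocol.neg_log_le_half_mutualInfo {A B M₁ M₂ N₁ N₂ : Type*}
    [Fintype A] [Fintype B] [Fintype M₁] [Fintype M₂] [Fintype N₁] [Fintype N₂]
    [DecidableEq A] [DecidableEq B] [DecidableEq M₁] [DecidableEq M₂]
    [DecidableEq N₁] [DecidableEq N₂]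
    (n : ℕ) (ε : ℝ)
    (ρ : Matrix (A × B) (A × B) ℂ) (hρ : IsDensity ρ)
    (P : Protocol n A B M₁ M₂ N₁ N₂)
    (hsuc : 1 - ε ≤ P.successProb ρ) :
    -Real.log (2 * (ε + (Real.cos (Real.pi / 8) ^ 2) ^ n)) ≤ (1 / 2) * mutualInfo ρ := by
  have hV₁ := P.opFst.entangledDilation_isometry
  have hV₂ := fun q => (P.opSnd q).dilation_isometry
  set E₂ := fun q =>
    (P.measSnd q).extend (K := Fin P.opFst.num) (L := Fin (P.opSnd q).num) with hE₂
  have hsum : (∑ q, winProb ρ P.opFst.entangledDilation (fun q => (P.opSnd q).dilation) P.measFst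
      E₂ q) / 2 ^ n = P.successProb ρ := by
    simp only [hE₂, winProb_eq_sum_successProbOn, ← Finset.mul_sum, Protocol.successProb]
    rw [one_div, inv_pow]
    field_simp
  -- Forced by the success probability being at most 1.
  have hε : 0 ≤ ε := by
    have h1 := Finset.sum_le_sum fun q (_ : q ∈ Finset.univ) =>
      winProb_le_one hρ hV₁ hV₂ P.measFst E₂ q
    rw [Finset.sum_const, Finset.card_univ] at h1
    have h2 : P.successProb ρ ≤ 1 := by
      rw [← hsum, div_le_one (by positivity)]
      simpa using h1
    linarith
  rw [← hsum] at hsuc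
  have hb := sqrt_two_inv_bounds
  rw [cos_sq_pi_div_eight]
  refine neg_log_le_half_of_bounds (by linarith) (by linarith) hε (mutualInfo_nonneg hρ)
    (fun hn => uncertainty_le_mutualInfo hρ hV₁ hV₂ P.measFst E₂ hn hsuc)
    (monogamy_le_mutualInfo hρ hV₁ hV₂ P.measFst E₂ hsuc rfl ?_)
  exact pow_le_one₀ (by linarith) (by linarith)

end B84

end

theorem lemma2 {A B M₁ M₂ N₁ N₂ : Type*}
    [Fintype A] [Fintype B] [Fintype M₁] [Fintype M₂] [Fintype N₁] [Fintype N₂]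
    [DecidableEq A] [DecidableEq B] [DecidableEq M₁] [DecidableEq M₂]
    [DecidableEq N₁] [DecidableEq N₂]
    (n : ℕ) (ε : ℝ)
    (ρ : Matrix (A × B) (A × B) ℂ) (hρ : B84.IsDensity ρ)
    (P : B84.Protocol n A B M₁ M₂ N₁ N₂)
    (hsuc : 1 - ε ≤ P.successProb ρ) :
    -Real.log (2 * (ε + (Real.cos (Real.pi / 8) ^ 2) ^ n)) ≤ (1 / 2) * B84.mutualInfo ρ :=
  B84.Protocol.neg_log_le_half_mutualInfo n ε ρ hρ P hsuc
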